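/- All languages are computable. A computable $\Sigma_1$ formula $\varphi(\bar x)$ is a computably enumerable disjunction of formulas $\exists\bar u\,\theta(\bar x,\bar u)$ with $\theta$ finitary and quantifier-free. For a structure $\mathcal B$, a relation $R\subseteq(\mathcal B^{<\omega})^k$ has a generalized computable $\Sigma_1$ definition (with parameters $\bar b$) if there is a computable sequence of computable $\Sigma_1$ formulas $\varphi_{n_1,\dots,n_k}$ such that $\varphi_{n_1,\dots,n_k}(\bar b,\bar x_1,\dots,\bar x_k)$ defines the restriction of $R$ to tuples $\bar x_j$ of length $n_j$. A relational structure $\mathcal A$, with basic relations $R_i$ of arity $k_i$, is effectively interpreted in $\mathcal B$ with parameters $\bar b$ if there are $D\subseteq\mathcal B^{<\omega}$, an equivalence relation $\equiv$ on $D$ and $\equiv$-invariant relations $R_i^*\subseteq D^{k_i}$ with $(D,(R_i^*)_i)/{\equiv}\;\cong\mathcal A$ such that $D$, $\equiv$, its complement in $D^2$, and (uniformly in $i$) $R_i^*$ and its complement in $D^{k_i}$ are defined by a computable sequence of generalized computable $\Sigma_1$ formulas with parameters $\bar b$. It is effectively interpreted in $\mathcal B$ (without parameters) if this holds with $\bar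 b$ the empty tuple. **Proposition.** Suppose that $\mathcal A$ has an effective interpretation in $\mathcal B$ with a finite tuple of parameters $\bar b$. For $\bar c$ in the orbit of $\bar b$ under $\mathrm{Aut}(\mathcal B)$, let $\mathcal A_{\bar c}$ be the copy of $\mathcal A$ obtained by replacing $\bar b$ by $\bar c$ in the defining formulas, with domain $D_{\bar c}/{\equiv_{\bar c}}$. Assume: 1. the orbit of $\bar b$ is defined by a computable $\Sigma_1$ formula (without parameters); 2. there is a relation $F$ of quadruples of finite tuples of $\mathcal B$, with a generalized computable $\Sigma_1$ definition without parameters, such that for all $\bar c,\bar d$ in the orbit of $\bar b$, the set of pairs $(\bar x,\bar y)\in D_{\bar c}\times D_{\bar d}$ with $(\bar c,\bar d,\bar x,\bar y)\in F$ is invariant under $\equiv_{\bar c}$ on $\bar x$ and under $\equiv_{\bar d}$ on $\bar y$, and defines an isomorphism $f_{\bar c,\bar d}$ from $\mathcal A_{\bar c}$ onto $\mathcal A_{\bar d}$, that is, $f_{\bar c,\bar d}([\bar x])=[\bar y]$ if and only if $(\bar c,\bar d,\bar x,\bar y)\in F$; 3. $f_{\bar c,\bar c}=\mathrm{id}$ and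 $f_{\bar d,\bar e}\circ f_{\bar c,\bar d}=f_{\bar c,\bar e}$ for all $\bar c,\bar d,\bar e$ in the orbit of $\bar b$. Then $\mathcal A$ is effectively interpreted in $\mathcal B$ without parameters. -/

import Mathlib

open FirstOrder FirstOrder.Language

universe u₁ v₁ u₂ v₂ w₁ w₂

namespace EffInt

/-- A computable language: the function symbols and the relation symbols carry (Goedel) numberings
from which the arity of a symbol can be computed. -/
class ComputableLanguage (L : FirstOrder.Language.{u₁, v₁}) where
  [primFunctions : Primcodable (Σ n, L.Functions n)]
  [primRelations : Primcodable (Σ n, L.Relations n)]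
  arityFunctions : Computable (fun f : Σ n, L.Functions n => f.1)
  arityRelations : Computable (fun R : Σ n, L.Relations n => R.1)

attribute [reducible, instance] ComputableLanguage.primFunctions ComputableLanguage.primRelations

/-- Codes of formulas `θ(x₀, …, x_{N-1})`: the number `N`, followed by a word in Polish notation
whose letters are (codes of) terms, relation symbols and natural numbers. -/
abbrev FormulaCode (L : FirstOrder.Language.{u₁, v₁}) : Type (max u₁ v₁) :=
  ℕ × List ((ℕ × List (ℕ ⊕ (Σ i, L.Functions i))) ⊕ ((Σ n, L.Relations n) ⊕ ℕ))

/-- The code of a term in the variables `x₀, …, x_{N-1}` and `k` further (bound) variables, which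
are numbered from `N` on. -/
def termCode {L : FirstOrder.Language.{u₁, v₁}} (N : ℕ) (t : Σ k, L.Term (Fin N ⊕ Fin k)) :
    ℕ × List (ℕ ⊕ (Σ i, L.Functions i)) :=
  (t.1, (t.2.relabel (Sum.elim (fun i : Fin N => (i : ℕ)) (fun j : Fin t.1 => N + (j : ℕ)))).listEncode)

/-- The Goedel number of a formula `θ(x₀, …, x_{N-1})`, built on Mathlib's encoding of formulas as
words (`BoundedFormula.listEncode`). -/
def formulaCode {L : FirstOrder.Language.{u₁, v₁}} (φ : Σ N, L.Formula (Fin N)) : FormulaCode L :=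
  (φ.1, (BoundedFormula.listEncode φ.2).map (Sum.map (termCode φ.1) id))

theorem relabel_injective {L : FirstOrder.Language.{u₁, v₁}} {α β : Type} {g : α → β}
    (hg : Function.Injective g) :
    Function.Injective (Term.relabel g : L.Term α → L.Term β) := by
  intro t
  induction t with
  | var a =>
    intro s h
    cases s with
    | var b => simp only [Term.relabel, Term.var.injEq] at h; rw [hg h]
    | func f ts => simp [Term.relabel] at h
  | func f ts ih =>
    intro s h
    cases s with
    | var b => simp [Term.relabel] at h
    | func f' ts' =>
      simp only [Term.relabel, Term.func.injEq] at h
      obtain ⟨rfl, h1, h2⟩ := h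
      cases h1
      congr 1
      funext i
      exact ih i (congrFun (eq_of_heq h2) i)

theorem termCode_injective {L : FirstOrder.Language.{u₁, v₁}} (N : ℕ) :
    Function.Injective (termCode (L := L) N) := by
  rintro ⟨k, t⟩ ⟨k', t'⟩ h
  simp only [termCode, Prod.mk.injEq] at h
  obtain ⟨rfl, h⟩ := h
  have hinj : Function.Injective
      (Sum.elim (fun i => (i : ℕ)) (fun j => N + (j : ℕ)) : Fin N ⊕ Fin k → ℕ) := by
    rintro (a | a) (b | b) hab
    · simp only [Sum.elim_inl] at hab; rw [Fin.ext hab]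
    · have := a.2; simp only [Sum.elim_inl, Sum.elim_inr] at hab; omega
    · have := b.2; simp only [Sum.elim_inl, Sum.elim_inr] at hab; omega
    · simp only [Sum.elim_inr] at hab; rw [Fin.ext (by omega : (a : ℕ) = b)]
  rw [relabel_injective hinj (Term.listEncode_injective h)]

/-- Distinct formulas have distinct codes. -/
theorem formulaCode_injective {L : FirstOrder.Language.{u₁, v₁}} :
    Function.Injective (formulaCode (L := L)) := by
  rintro ⟨N, φ⟩ ⟨N', φ'⟩ h
  simp only [formulaCode, Prod.mk.injEq] at h
  obtain ⟨rfl, h⟩ := h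
  have h2 := List.map_injective_iff.2
    (Sum.map_injective.2 ⟨termCode_injective N, Function.injective_id⟩) h
  have h3 := BoundedFormula.listEncode_sigma_injective (L := L) (α := Fin N)
    (a₁ := ⟨0, φ⟩) (a₂ := ⟨0, φ'⟩) h2
  simpa using h3

/-- A computable sequence `(φ_i)`, `i ∈ ι`, of computable `Σ₁` formulas, `φ_i` having the free
variables `x₀, …, x_{ar i - 1}`.  Each `φ_i` is a computably enumerable disjunction of formulas
`∃ x_{ar i} ⋯ ∃ x_{N-1} θ(x₀, …, x_{N-1})` with `θ` finitary and quantifier-free; such a disjunct is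
given by the pair `⟨N, θ⟩`, and `disj i` is the set of disjuncts of `φ_i`.  The disjuncts are
computably enumerable uniformly in `i`. -/
structure SigmaOneSeq (L : FirstOrder.Language.{u₁, v₁}) [ComputableLanguage L] (ι : Type w₁) [Primcodable ι]
    (ar : ι → ℕ) where
  disj : ι → Set (Σ N, L.Formula (Fin N))
  ar_le : ∀ i, ∀ θ ∈ disj i, ar i ≤ θ.1
  isQF : ∀ i, ∀ θ ∈ disj i, BoundedFormula.IsQF θ.2
  ce : REPred (fun z : ι × FormulaCode L => ∃ θ ∈ disj z.1, formulaCode θ = z.2)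

/-- The tuple `x̄ ∈ B^{ar i}` satisfies `φ_i`: for some disjunct `⟨N, θ⟩`, the tuple can be extended
to an `N`-tuple which satisfies `θ`. -/
def SigmaOneSeq.Realize {L : FirstOrder.Language.{u₁, v₁}} [ComputableLanguage L] {ι : Type w₁} [Primcodable ι]
    {ar : ι → ℕ} (Φ : SigmaOneSeq L ι ar) {B : Type w₂} [L.Structure B] (i : ι) (x : List B) :
    Prop :=
  x.length = ar i ∧
    ∃ θ ∈ Φ.disj i, ∃ v : Fin θ.1 → B, x <+: List.ofFn v ∧ Formula.Realize θ.2 v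

/-- A computable `Σ₁` formula in `p` free variables. -/
abbrev SigmaOneFormula (L : FirstOrder.Language.{u₁, v₁}) [ComputableLanguage L] (p : ℕ) :=
  SigmaOneSeq L Unit (fun _ => p)

/-- A computable sequence, indexed by `ι`, of generalized computable `Σ₁` formulas with `p`
parameters.  A generalized formula `ψ(ū; x̄₁, …, x̄_k)`, whose variables `x̄_j` range over the tuples
of arbitrary finite length, is the sequence of its instances
`ψ_{n₁, …, n_k}(ū; x̄₁, …, x̄_k)` for `x̄_j` of length `n_j`; the instance is indexed by the list
`[n₁, …, n_k]` and has arity `p + n₁ + ⋯ + n_k`. -/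
abbrev GenSigmaOneSeq (L : FirstOrder.Language.{u₁, v₁}) [ComputableLanguage L] (ι : Type w₁) [Primcodable ι]
    (p : ℕ) :=
  SigmaOneSeq L (ι × List ℕ) (fun s => p + s.2.sum)

/-- The `i`-th generalized formula holds of the tuples `x̄₁, …, x̄_k` with parameters `c̄`. -/
def GenHolds {L : FirstOrder.Language.{u₁, v₁}} [ComputableLanguage L] {ι : Type w₁} [Primcodable ι] {p : ℕ}
    (Φ : GenSigmaOneSeq L ι p) {B : Type w₂} [L.Structure B] (i : ι) (c : Fin p → B)
    (xs : List (List B)) : Prop :=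
  Φ.Realize (i, xs.map List.length) (List.ofFn c ++ xs.flatten)

/-- The formulas of a would-be effective interpretation, with `p` parameters, of a structure for the
relational language `LA` in a structure for `LB`: generalized computable `Σ₁` formulas for the
domain, for `≡` and its complement, and (uniformly in the symbol `R`) for `R*` and its
complement. -/
structure InterpFormulas (LA : FirstOrder.Language.{u₁, v₁}) (LB : FirstOrder.Language.{u₂, v₂}) [ComputableLanguage LA]
    [ComputableLanguage LB] (p : ℕ) where
  dom : GenSigmaOneSeq LB Unit p
  eqv : GenSigmaOneSeq LB Unit p
  neqv : GenSigmaOneSeq LB Unit p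
  rel : GenSigmaOneSeq LB (Σ n, LA.Relations n) p
  nrel : GenSigmaOneSeq LB (Σ n, LA.Relations n) p

namespace InterpFormulas

variable {LA : FirstOrder.Language.{u₁, v₁}} {LB : FirstOrder.Language.{u₂, v₂}} [ComputableLanguage LA]
  [ComputableLanguage LB] {p : ℕ} {B : Type w₂} [LB.Structure B]

/-- The set `D_c̄` of finite tuples. -/
def D (Φ : InterpFormulas LA LB p) (c : Fin p → B) : Set (List B) :=
  {x | GenHolds Φ.dom () c [x]}

/-- The relation `≡_c̄`. -/
def Eqv (Φ : InterpFormulas LA LB p) (c : Fin p → B) (x y : List B) : Prop :=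
  GenHolds Φ.eqv () c [x, y]

/-- The relation defined by the formula for the complement of `≡_c̄`. -/
def Neqv (Φ : InterpFormulas LA LB p) (c : Fin p → B) (x y : List B) : Prop :=
  GenHolds Φ.neqv () c [x, y]

/-- The relation `R*`. -/
def Rel (Φ : InterpFormulas LA LB p) (c : Fin p → B) {n : ℕ} (R : LA.Relations n)
    (xs : Fin n → List B) : Prop :=
  GenHolds Φ.rel ⟨n, R⟩ c (List.ofFn xs)

/-- The relation defined by the formula for the complement of `R*`. -/
def Nrel (Φ : InterpFormulas LA LB p) (c : Fin p → B) {n : ℕ} (R : LA.Relations n)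
    (xs : Fin n → List B) : Prop :=
  GenHolds Φ.nrel ⟨n, R⟩ c (List.ofFn xs)

/-- The universe `D_c̄ / ≡_c̄` of the structure defined by the formulas with parameters `c̄`. -/
def Model (Φ : InterpFormulas LA LB p) (c : Fin p → B) : Type w₂ :=
  Quot (fun x y : Φ.D c => Φ.Eqv c x y)

/-- The class of a tuple of `D_c̄`. -/
def cls (Φ : InterpFormulas LA LB p) (c : Fin p → B) (x : Φ.D c) : Φ.Model c :=
  Quot.mk _ x

/-- The quotient structure `(D_c̄, (R*)) / ≡_c̄`. -/
instance modelStructure [LA.IsRelational] (Φ : InterpFormulas LA LB p) (c : Fin p → B) :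
    LA.Structure (Φ.Model c) where
  funMap f _ := isEmptyElim f
  RelMap R q := ∃ xs : Fin _ → Φ.D c, (∀ j, Φ.cls c (xs j) = q j) ∧ Φ.Rel c R (fun j => xs j)

/-- The formulas, with the parameters `c̄`, form an effective interpretation of `A` in `B`: `≡` is an
equivalence relation on `D` and the `R*` are relations on `D` which are invariant under `≡`; the
complementary formulas define the complements in `D²` and in `D^k`; and
`(D, (R*)) / ≡` is isomorphic to `A`. -/
structure Interprets [LA.IsRelational] (Φ : InterpFormulas LA LB p) (c : Fin p → B)
    (A : Type w₁) [LA.Structure A] : Prop where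
  eqv_dom : ∀ x y, Φ.Eqv c x y → x ∈ Φ.D c ∧ y ∈ Φ.D c
  eqv_equivalence : Equivalence (fun x y : Φ.D c => Φ.Eqv c x y)
  neqv_iff : ∀ x y, Φ.Neqv c x y ↔ x ∈ Φ.D c ∧ y ∈ Φ.D c ∧ ¬ Φ.Eqv c x y
  rel_dom : ∀ {n : ℕ} (R : LA.Relations n) (xs : Fin n → List B),
    Φ.Rel c R xs → ∀ j, xs j ∈ Φ.D c
  rel_invariant : ∀ {n : ℕ} (R : LA.Relations n) (xs ys : Fin n → List B),
    (∀ j, Φ.Eqv c (xs j) (ys j)) → (Φ.Rel c R xs ↔ Φ.Rel c R ys)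
  nrel_iff : ∀ {n : ℕ} (R : LA.Relations n) (xs : Fin n → List B),
    Φ.Nrel c R xs ↔ (∀ j, xs j ∈ Φ.D c) ∧ ¬ Φ.Rel c R xs
  iso : Nonempty (Φ.Model c ≃[LA] A)

end InterpFormulas

/-- `A` is effectively interpreted in `B`, without parameters. -/
def EffectivelyInterpreted (LA : FirstOrder.Language.{u₁, v₁}) (LB : FirstOrder.Language.{u₂, v₂}) [LA.IsRelational]
    [ComputableLanguage LA] [ComputableLanguage LB] (A : Type w₁) [LA.Structure A]
    (B : Type w₂) [LB.Structure B] : Prop :=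
  ∃ Φ : InterpFormulas LA LB 0, Φ.Interprets (Fin.elim0 : Fin 0 → B) A

/-- The orbit of a tuple under the automorphism group. -/
def orbit (L : FirstOrder.Language.{u₂, v₂}) {B : Type w₂} [L.Structure B] {p : ℕ} (b : Fin p → B) :
    Set (Fin p → B) :=
  {c | ∃ σ : B ≃[L] B, c = σ ∘ b}

/-- The quaternary relation `(c̄, d̄, x̄, ȳ) ∈ F` defined by a generalized computable `Σ₁` formula
without parameters. -/
def quaternary {L : FirstOrder.Language.{u₂, v₂}} [ComputableLanguage L] {B : Type w₂} [L.Structure B] {p : ℕ}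
    (F : GenSigmaOneSeq L Unit 0) (c d : Fin p → B) (x y : List B) : Prop :=
  GenHolds F () (Fin.elim0 : Fin 0 → B) [List.ofFn c, List.ofFn d, x, y]

end EffInt

/-!
For `c̄` in the orbit of `b̄`, and more generally in any set defined by `φ`, the formulas with
parameters `c̄` interpret a copy of `A`. Rather than choosing parameters, take all these
interpretations at once: the new domain consists of the tuples `c̄x̄` with `x̄ ∈ D_c̄`. By
functoriality the maps `f_c̄d̄` identify all the copies with one and the same structure, so `d̄x̄` and
`c̄ȳ` name the same element exactly if `(d̄, c̄, x̄, ȳ) ∈ F`. A relation thus holds of `d̄₁x̄₁, …, d̄ₖx̄ₖ`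
if and only if, for some `c̄` and some `ȳⱼ` with `(d̄ⱼ, c̄, x̄ⱼ, ȳⱼ) ∈ F`, the formula with parameters
`c̄` holds of `ȳ₁, …, ȳₖ`. This is a generalized computable `Σ₁` condition, and it serves the domain,
`≡`, the relations and the complements alike. Its disjuncts range over all ways to pick the
variables for `c̄` and the `ȳⱼ`, and over disjuncts of the formulas involved.
-/

namespace EffInt

section RecursivelyEnumerable

variable {α β : Type*} [Primcodable α] [Primcodable β]

theorem rePred_of_exists_primrecRel {r : α → β → Prop} (hr : PrimrecRel r) :
    REPred fun a => ∃ b, r a b := by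
  classical
  let test (a : α) (n : ℕ) : Bool :=
    ((Encodable.decode n : Option β).map fun b => decide (r a b)).getD false
  have htest : Primrec₂ test :=
    Primrec.option_getD.comp
      (Primrec.option_map (Primrec.decode.comp Primrec.snd)
        (PrimrecPred.decide (hr.comp (Primrec.fst.comp Primrec.fst) Primrec.snd)).to₂)
      (Primrec.const false)
  have hsearch : Partrec fun a => Nat.rfind fun n => (Part.some (test a n) : Part Bool) :=
    Partrec.rfind (Computable₂.partrec₂ htest.to_comp)
  refine hsearch.dom_re.of_eq fun a => Nat.rfind_dom.trans ⟨?_, ?_⟩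
  · rintro ⟨n, hn, -⟩
    have hn := Part.mem_some_iff.1 hn
    cases hd : (Encodable.decode n : Option β) with
    | none => simp [test, hd] at hn
    | some b => exact ⟨b, by simpa [test, hd] using hn.symm⟩
  · rintro ⟨b, hb⟩
    exact ⟨Encodable.encode b, Part.mem_some_iff.2 (by simpa [test] using hb), fun _ => trivial⟩

theorem rePred_iff_exists_primrecRel {p : α → Prop} :
    REPred p ↔ ∃ r : α → ℕ → Prop, PrimrecRel r ∧ ∀ a, p a ↔ ∃ n, r a n := by
  refine ⟨fun hp => ?_, fun ⟨r, hr, h⟩ =>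
    (rePred_of_exists_primrecRel hr).of_eq fun a => (h a).symm⟩
  obtain ⟨c, hc⟩ := Nat.Partrec.Code.exists_code.1 hp
  refine ⟨fun a n => (Nat.Partrec.Code.evaln n c (Encodable.encode a)).isSome = true,
    ⟨fun _ => inferInstance, ?_⟩, fun a => ?_⟩
  · have hprim := Primrec.option_isSome.comp (Nat.Partrec.Code.primrec_evaln.comp
      ((Primrec.snd (α := α) (β := ℕ)).pair (Primrec.const c) |>.pair
        (Primrec.encode.comp Primrec.fst)))
    exact hprim.of_eq fun a => by simp
  · have hdom : p a ↔ (Nat.Partrec.Code.eval c (Encodable.encode a)).Dom := by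
      simp [hc, Part.assert]
    simp only [hdom, Part.dom_iff_mem, Nat.Partrec.Code.evaln_complete,
      Option.isSome_iff_exists, Option.mem_def]
    exact exists_comm

theorem rePred_comp {p : β → Prop} (hp : REPred p) {f : α → β} (hf : Computable f) :
    REPred fun a => p (f a) :=
  Partrec.comp hp hf

theorem rePred_and {p q : α → Prop} (hp : REPred p) (hq : REPred q) :
    REPred fun a => p a ∧ q a := by
  obtain ⟨r, hr, hpr⟩ := rePred_iff_exists_primrecRel.1 hp
  obtain ⟨s, hs, hqs⟩ := rePred_iff_exists_primrecRel.1 hq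
  refine (rePred_of_exists_primrecRel (r := fun a (n : ℕ × ℕ) => r a n.1 ∧ s a n.2)
    (PrimrecPred.and (hr.comp Primrec.fst (Primrec.fst.comp Primrec.snd))
      (hs.comp Primrec.fst (Primrec.snd.comp Primrec.snd)))).of_eq fun a => ?_
  rw [hpr, hqs, Prod.exists, exists_and_exists_comm]

theorem rePred_exists {p : α × β → Prop} (hp : REPred p) : REPred fun a => ∃ b, p (a, b) := by
  obtain ⟨r, hr, hpr⟩ := rePred_iff_exists_primrecRel.1 hp
  refine (rePred_of_exists_primrecRel (r := fun a (n : β × ℕ) => r (a, n.1) n.2)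
    (hr.comp (Primrec.fst.pair (Primrec.fst.comp Primrec.snd))
      (Primrec.snd.comp Primrec.snd))).of_eq fun a => ?_
  simp only [hpr, Prod.exists]

end RecursivelyEnumerable

theorem exists_map_eq_and_forall_mem_iff {α β : Type*} {f : α → β} {P : α → Prop} {l : List β} :
    (∃ l' : List α, l'.map f = l ∧ ∀ a ∈ l', P a) ↔ ∀ b ∈ l, ∃ a, f a = b ∧ P a := by
  constructor
  · rintro ⟨l', rfl, h⟩ b hb
    obtain ⟨a, ha, rfl⟩ := List.mem_map.1 hb
    exact ⟨a, rfl, h a ha⟩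
  · intro h
    choose g hgf hgP using h
    exact ⟨l.attach.map fun b => g b.1 b.2, by simp [hgf],
      List.forall_mem_map.2 fun b _ => hgP b.1 b.2⟩

theorem rePred_forall_mem {α : Type*} [Primcodable α] {p : α → Prop} (hp : REPred p) :
    REPred fun l : List α => ∀ a ∈ l, p a := by
  obtain ⟨r, hr, hpr⟩ := rePred_iff_exists_primrecRel.1 hp
  have hwitnesses : PrimrecRel fun (l : List α) (l' : List (α × ℕ)) =>
      l'.map Prod.fst = l ∧ ∀ x ∈ l', r x.1 x.2 :=
    PrimrecPred.and
      (Primrec.eq.comp (Primrec.list_map Primrec.snd (Primrec.fst.comp Primrec.snd).to₂)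
        Primrec.fst)
      ((PrimrecPred.forall_mem_list hr).comp Primrec.snd)
  refine (rePred_of_exists_primrecRel hwitnesses).of_eq fun l => ?_
  simp only [exists_map_eq_and_forall_mem_iff, hpr, Prod.exists, exists_eq_left,
    exists_and_left, exists_eq_left]

section Codes

variable {L : FirstOrder.Language.{u₁, v₁}}

/-- The letters of the words that occur in codes of formulas, see `FormulaCode`. -/
abbrev Letter (L : FirstOrder.Language.{u₁, v₁}) : Type (max u₁ v₁) :=
  (ℕ × List (ℕ ⊕ (Σ i, L.Functions i))) ⊕ ((Σ n, L.Relations n) ⊕ ℕ)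

/-- The effect on the code of a quantifier-free formula, letter by letter, of replacing each
variable `v` by the variable `g v`. -/
def renameLetter (g : ℕ → ℕ) : Letter L → Letter L :=
  Sum.map (Prod.map id (List.map (Sum.map g id))) id

theorem listEncode_relabel {α β : Type} (g : α → β) (t : L.Term α) :
    (t.relabel g).listEncode = t.listEncode.map (Sum.map g id) := by
  induction t with
  | var a => simp [Term.relabel, Term.listEncode]
  | func f ts ih =>
    simp only [Term.relabel, Term.listEncode, List.map_cons, Sum.map_inr, id, List.map_flatMap]
    exact congrArg _ (List.flatMap_congr fun i _ => ih i)

theorem termCode_relabel {N N' : ℕ} (g : Fin N → Fin N') {g' : ℕ → ℕ}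
    (hg : ∀ i, (g i : ℕ) = g' i) (t : L.Term (Fin N ⊕ Fin 0)) :
    termCode N' ⟨0, t.relabel (Sum.map g id)⟩ =
      Prod.map id (List.map (Sum.map g' id)) (termCode N ⟨0, t⟩) := by
  have hvar : Sum.elim (fun i : Fin N' => (i : ℕ)) (fun j : Fin 0 => N' + (j : ℕ)) ∘ Sum.map g id =
      g' ∘ Sum.elim (fun i : Fin N => (i : ℕ)) (fun j : Fin 0 => N + (j : ℕ)) := by
    ext (i | i)
    · exact hg i
    · exact i.elim0
  simp only [termCode, Prod.map_apply, id, ← listEncode_relabel, Term.relabel_relabel, hvar]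

theorem formulaCode_relabel {N N' : ℕ} (g : Fin N → Fin N') {g' : ℕ → ℕ}
    (hg : ∀ i, (g i : ℕ) = g' i) {φ : L.Formula (Fin N)} (hφ : BoundedFormula.IsQF φ) :
    formulaCode ⟨N', φ.relabel g⟩ = (N', (formulaCode ⟨N, φ⟩).2.map (renameLetter g')) := by
  have haux : BoundedFormula.relabelAux (Sum.inl ∘ g) 0 =
      (Sum.map g id : Fin N ⊕ Fin 0 → Fin N' ⊕ Fin 0) := by
    ext (i | i)
    · rfl
    · exact i.elim0
  have hterm (t : L.Term (Fin N ⊕ Fin 0)) :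
      termCode N' ⟨0, t.relabel (BoundedFormula.relabelAux (Sum.inl ∘ g) 0)⟩ =
        Prod.map id (List.map (Sum.map g' id)) (termCode N ⟨0, t⟩) := by
    rw [← termCode_relabel g hg, ← haux]
  refine Prod.ext rfl ?_
  induction hφ with
  | falsum => rfl
  | of_isAtomic h =>
    cases h with
    | equal t₁ t₂ =>
      simp [formulaCode, Formula.relabel, BoundedFormula.relabel, BoundedFormula.mapTermRel,
        BoundedFormula.listEncode, renameLetter, hterm, Term.bdEqual]
    | rel R ts =>
      simp [formulaCode, Formula.relabel, BoundedFormula.relabel, BoundedFormula.mapTermRel,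
        BoundedFormula.listEncode, renameLetter, hterm, Relations.boundedFormula]
  | imp _ _ ih₁ ih₂ =>
    simp only [formulaCode, Formula.relabel] at ih₁ ih₂ ⊢
    simp [BoundedFormula.listEncode, renameLetter, ih₁, ih₂]

end Codes

section Conjunctions

variable {L : FirstOrder.Language.{u₁, v₁}}

/-- The conjunction of finitely many formulas in the variables `x₀, …, x_{N-1}`. -/
def conj {N : ℕ} (l : List (L.Formula (Fin N))) : L.Formula (Fin N) :=
  l.foldr (· ⊓ ·) ⊤

/-- The operation on codes that corresponds to the conjunction of two formulas. Mathlib defines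
`φ ⊓ ψ` as `(φ ⟹ ψ ⟹ ⊥) ⟹ ⊥` and writes implications in Polish notation, with the letter `0` for `⟹`
and the letter `2` for `⊥` in zero bound variables. -/
def infCode (c c' : List (Letter L)) : List (Letter L) :=
  .inr (.inr 0) :: .inr (.inr 0) :: (c ++ .inr (.inr 0) :: (c' ++ [.inr (.inr 2)])) ++
    [.inr (.inr 2)]

/-- The operation on codes that corresponds to `conj`; the conjunction of the empty list is
`⊤ = (⊥ ⟹ ⊥)`. -/
def conjCode (l : List (List (Letter L))) : List (Letter L) :=
  l.foldr infCode [.inr (.inr 0), .inr (.inr 2), .inr (.inr 2)]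

theorem realize_conj {B : Type w₂} [L.Structure B] {N : ℕ} {l : List (L.Formula (Fin N))}
    {v : Fin N → B} : (conj l).Realize v ↔ ∀ ψ ∈ l, ψ.Realize v :=
  BoundedFormula.realize_foldr_inf l v default

theorem isQF_conj {N : ℕ} {l : List (L.Formula (Fin N))}
    (h : ∀ ψ ∈ l, BoundedFormula.IsQF ψ) : BoundedFormula.IsQF (conj l) := by
  induction l with
  | nil => exact .top
  | cons ψ l ih =>
    exact (h ψ List.mem_cons_self).inf (ih fun χ hχ => h χ (List.mem_cons_of_mem _ hχ))

theorem formulaCode_inf {N : ℕ} (φ ψ : L.Formula (Fin N)) :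
    formulaCode ⟨N, φ ⊓ ψ⟩ = (N, infCode (formulaCode ⟨N, φ⟩).2 (formulaCode ⟨N, ψ⟩).2) := by
  change formulaCode ⟨N, (BoundedFormula.imp φ (BoundedFormula.imp ψ .falsum)).imp .falsum⟩ = _
  simp [formulaCode, infCode, BoundedFormula.listEncode]

theorem formulaCode_conj {N : ℕ} (l : List (L.Formula (Fin N))) :
    formulaCode ⟨N, conj l⟩ = (N, conjCode (l.map fun ψ => (formulaCode ⟨N, ψ⟩).2)) := by
  induction l with
  | nil =>
    change formulaCode ⟨N, BoundedFormula.imp .falsum .falsum⟩ = _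
    simp [formulaCode, BoundedFormula.listEncode, conjCode]
  | cons ψ l ih => exact (formulaCode_inf ψ (conj l)).trans (by rw [ih]; rfl)

theorem exists_formulaCode_conj_iff {σ : Type*} {N : ℕ} {S : List σ → Prop}
    {T : σ → Set (L.Formula (Fin N))} {c : List (Letter L)} :
    (∃ l : List (σ × L.Formula (Fin N)), S (l.map Prod.fst) ∧ (∀ a ∈ l, a.2 ∈ T a.1) ∧
        formulaCode ⟨N, conj (l.map Prod.snd)⟩ = (N, c)) ↔
      ∃ l : List (σ × List (Letter L)), S (l.map Prod.fst) ∧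
        (∀ a ∈ l, ∃ ψ ∈ T a.1, formulaCode ⟨N, ψ⟩ = (N, a.2)) ∧ conjCode (l.map Prod.snd) = c := by
  let code (a : σ × L.Formula (Fin N)) : σ × List (Letter L) := (a.1, (formulaCode ⟨N, a.2⟩).2)
  have hcode (l : List (σ × L.Formula (Fin N))) :
      formulaCode ⟨N, conj (l.map Prod.snd)⟩ = (N, conjCode ((l.map code).map Prod.snd)) := by
    rw [formulaCode_conj, List.map_map, List.map_map]
    rfl
  have hfst (l : List (σ × L.Formula (Fin N))) : (l.map code).map Prod.fst = l.map Prod.fst :=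
    List.map_map
  constructor
  · rintro ⟨l, hS, hl, hc⟩
    refine ⟨l.map code, (hfst l).symm ▸ hS,
      List.forall_mem_map.2 fun a ha => ⟨a.2, hl a ha, rfl⟩, ?_⟩
    exact (Prod.mk.inj ((hcode l).symm.trans hc)).2
  · rintro ⟨l, hS, hl, rfl⟩
    obtain ⟨l, rfl, hl'⟩ := exists_map_eq_and_forall_mem_iff (f := code)
      (P := fun a => a.2 ∈ T a.1).2 fun a ha => by
        obtain ⟨ψ, hψ, hc⟩ := hl a ha
        exact ⟨(a.1, ψ), Prod.ext rfl (Prod.mk.inj hc).2, hψ⟩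
    exact ⟨l, hfst l ▸ hS, hl', hcode l⟩

variable [ComputableLanguage L]

theorem primrec_infCode : Primrec₂ (infCode (L := L)) := by
  unfold infCode
  exact Primrec.list_append.comp
    (Primrec.list_cons.comp (Primrec.const _) (Primrec.list_cons.comp (Primrec.const _)
      (Primrec.list_append.comp Primrec.fst (Primrec.list_cons.comp (Primrec.const _)
        (Primrec.list_append.comp Primrec.snd (Primrec.const _)))))) (Primrec.const _)

theorem primrec_conjCode : Primrec (conjCode (L := L)) :=
  Primrec.list_foldr Primrec.id (Primrec.const _)
    (primrec_infCode.comp (Primrec.fst.comp Primrec.snd) (Primrec.snd.comp Primrec.snd)).to₂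

theorem primrec_renameLetter {α : Type*} [Primcodable α] {g : α → ℕ → ℕ} (hg : Primrec₂ g) :
    Primrec₂ fun (a : α) (c : Letter L) => renameLetter (g a) c := by
  have hletter : Primrec₂ fun (a : α) (s : ℕ ⊕ (Σ i, L.Functions i)) => Sum.map (g a) id s :=
    (Primrec.sumCasesOn Primrec.snd
      (Primrec.sumInl.comp (hg.comp (Primrec.fst.comp Primrec.fst) Primrec.snd)).to₂
      (Primrec.sumInr.comp Primrec.snd).to₂).of_eq fun x => by rcases x with ⟨_, _ | _⟩ <;> rfl
  have hterm : Primrec₂ fun (a : α) (t : List (ℕ ⊕ (Σ i, L.Functions i))) =>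
      t.map (Sum.map (g a) id) :=
    Primrec.list_map Primrec.snd (hletter.comp (Primrec.fst.comp Primrec.fst) Primrec.snd).to₂
  exact (Primrec.sumCasesOn Primrec.snd
      (Primrec.sumInl.comp ((Primrec.fst.comp Primrec.snd).pair (hterm.comp
        (Primrec.fst.comp Primrec.fst) (Primrec.snd.comp Primrec.snd)))).to₂
      (Primrec.sumInr.comp Primrec.snd).to₂).of_eq fun x => by rcases x with ⟨_, _ | _⟩ <;> rfl

end Conjunctions

section Values

variable {B : Type*}

/-- The values of the variables `vs` under the assignment `z` of values to the variables
`x₀, …, x_{n-1}`, where `n` is the length of `z`; the variables outside this range are skipped. -/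
def vals (z : List B) (vs : List ℕ) : List B :=
  vs.filterMap (z[·]?)

theorem vals_append (z : List B) (vs ws : List ℕ) : vals z (vs ++ ws) = vals z vs ++ vals z ws :=
  List.filterMap_append

theorem map_getElem?_eq_map_some_vals {z : List B} {vs : List ℕ} (h : ∀ v ∈ vs, v < z.length) :
    vs.map (z[·]?) = (vals z vs).map some := by
  induction vs with
  | nil => rfl
  | cons v vs ih =>
    rw [List.forall_mem_cons] at h
    simp [vals, List.getElem?_eq_getElem h.1, ih h.2]

theorem length_vals {z : List B} {vs : List ℕ} (h : ∀ v ∈ vs, v < z.length) :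
    (vals z vs).length = vs.length := by
  simpa using (congrArg List.length (map_getElem?_eq_map_some_vals h)).symm

theorem vals_ofFn {k N : ℕ} (w : Fin N → B) (g : Fin k → Fin N) :
    vals (List.ofFn w) (List.ofFn fun i => (g i : ℕ)) = List.ofFn (w ∘ g) := by
  apply List.map_injective_iff.2 (Option.some_injective B)
  rw [← map_getElem?_eq_map_some_vals (by simp [List.mem_ofFn])]
  simp [List.map_ofFn, Function.comp_def]

theorem exists_vals_eq {z y : List B} (h : y ⊆ z) :
    ∃ vs, vals z vs = y ∧ ∀ v ∈ vs, v < z.length := by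
  induction y with
  | nil => exact ⟨[], rfl, by simp⟩
  | cons a y ih =>
    rw [List.cons_subset] at h
    obtain ⟨v, hv, rfl⟩ := List.mem_iff_getElem.1 h.1
    obtain ⟨vs, rfl, hvs⟩ := ih h.2
    exact ⟨v :: vs, by simp [vals, hv], List.forall_mem_cons.2 ⟨hv, hvs⟩⟩

theorem vals_eq_of_prefix {z w : List B} (h : z <+: w) {vs : List ℕ}
    (hvs : ∀ v ∈ vs, v < z.length) : vals w vs = vals z vs :=
  List.filterMap_congr fun v hv => (List.prefix_iff_getElem?.1 h v (hvs v hv)).trans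
    (List.getElem?_eq_getElem (hvs v hv)).symm

theorem vals_range' {pre x z : List B} (h : pre ++ x <+: z) :
    vals z (List.range' pre.length x.length) = x := by
  rw [vals_eq_of_prefix h (by simp)]
  apply List.map_injective_iff.2 (Option.some_injective B)
  rw [← map_getElem?_eq_map_some_vals (by simp)]
  refine List.ext_getElem (by simp) fun i h₁ h₂ => ?_
  simp [List.getElem?_append, show i < x.length by simpa using h₂]

end Values

namespace SigmaOneSeq

variable {L : FirstOrder.Language.{u₁, v₁}} [ComputableLanguage L] {ι : Type w₁} [Primcodable ι]
  {ar : ι → ℕ}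

/-- The formulas in `x₀, …, x_{N-1}` that arise from the disjuncts of `Φ i` by substituting the
variables `vs` for the free variables of `Φ i` and arbitrary variables for the remaining ones. As
all choices of the latter are allowed, no fresh variables have to be provided. -/
def instances (Φ : SigmaOneSeq L ι ar) (N : ℕ) (i : ι) (vs : List ℕ) : Set (L.Formula (Fin N)) :=
  {ψ | vs.length = ar i ∧ ∃ θ ∈ Φ.disj i, ∃ g : Fin θ.1 → Fin N,
    vs <+: List.ofFn (fun j => (g j : ℕ)) ∧ ψ = θ.2.relabel g}

theorem isQF_of_mem_instances {Φ : SigmaOneSeq L ι ar} {N : ℕ} {i : ι} {vs : List ℕ}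
    {ψ : L.Formula (Fin N)} (h : ψ ∈ Φ.instances N i vs) : BoundedFormula.IsQF ψ := by
  obtain ⟨-, θ, hθ, g, -, rfl⟩ := h
  exact (Φ.isQF i θ hθ).relabel _

section Semantics

variable {B : Type w₂} [L.Structure B]

theorem realize_of_mem_instances {Φ : SigmaOneSeq L ι ar} {N : ℕ} {i : ι} {vs : List ℕ}
    {ψ : L.Formula (Fin N)} (h : ψ ∈ Φ.instances N i vs) {w : Fin N → B} (hw : ψ.Realize w) :
    (∀ v ∈ vs, v < N) ∧ Φ.Realize i (vals (List.ofFn w) vs) := by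
  obtain ⟨hvs, θ, hθ, g, hg, rfl⟩ := h
  have hlt : ∀ v ∈ vs, v < N := fun v hv => by
    obtain ⟨j, rfl⟩ := List.mem_ofFn.1 (hg.subset hv)
    exact (g j).2
  refine ⟨hlt, ?_, θ, hθ, w ∘ g, ?_, Formula.realize_relabel.1 hw⟩
  · rw [length_vals (by simpa using hlt), hvs]
  · rw [← vals_ofFn]
    exact hg.filterMap _

theorem exists_realize_mem_instances {Φ : SigmaOneSeq L ι ar} {i : ι} {vs : List ℕ} {z : List B}
    (hvs : ∀ v ∈ vs, v < z.length) (h : Φ.Realize i (vals z vs)) :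
    ∃ t : List B, ∀ w, z <+: w → t ⊆ w → ∃ ψ ∈ Φ.instances w.length i vs, ψ.Realize w.get := by
  obtain ⟨hlen, ⟨N, θ⟩, hθ, v, ⟨r, hr⟩, hv⟩ := h
  refine ⟨r, fun w hzw hrw => ?_⟩
  obtain ⟨us, hus, hus_lt⟩ := exists_vals_eq hrw
  have hlt : ∀ u ∈ vs ++ us, u < w.length := List.forall_mem_append.2
    ⟨fun u hu => (hvs u hu).trans_le hzw.length_le, hus_lt⟩
  have hvals : vals w (vs ++ us) = List.ofFn v := by
    rw [vals_append, vals_eq_of_prefix hzw hvs, hus, hr]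
  obtain rfl : (vs ++ us).length = N := by
    rw [← length_vals hlt, hvals, List.length_ofFn]
  let g : Fin (vs ++ us).length → Fin w.length := fun j => ⟨(vs ++ us)[j], hlt _ (by simp)⟩
  have hg : List.ofFn (fun j => (g j : ℕ)) = vs ++ us := List.ofFn_getElem
  have hgv : w.get ∘ g = v := by
    rw [← List.ofFn_inj, ← vals_ofFn, List.ofFn_get, hg, hvals]
  refine ⟨θ.relabel g, ⟨?_, ⟨_, θ⟩, hθ, g, ⟨us, hg.symm⟩, rfl⟩,
    Formula.realize_relabel.2 (hgv ▸ hv)⟩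
  rw [← hlen, length_vals hvs]

end Semantics

theorem exists_mem_instances_iff {Φ : SigmaOneSeq L ι ar} {i : ι} {vs : List ℕ}
    {c : FormulaCode L} :
    (∃ ψ ∈ Φ.instances c.1 i vs, formulaCode ⟨c.1, ψ⟩ = c) ↔
      vs.length = ar i ∧ ∃ (c₀ : FormulaCode L) (us : List ℕ),
        (∃ θ ∈ Φ.disj i, formulaCode θ = c₀) ∧ (vs ++ us).length = c₀.1 ∧
        (∀ u ∈ vs ++ us, u < c.1) ∧ c₀.2.map (renameLetter ((vs ++ us).getD · 0)) = c.2 := by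
  constructor
  · rintro ⟨_, ⟨hvs, θ, hθ, g, ⟨us, hus⟩, rfl⟩, hc⟩
    refine ⟨hvs, _, us, ⟨θ, hθ, rfl⟩, ?_, ?_, ?_⟩
    · simp [hus, formulaCode]
    · simp [hus, List.mem_ofFn]
    · rw [← hc, formulaCode_relabel g (fun j => ?_) (Φ.isQF i θ hθ)]
      simp [hus]
  · rintro ⟨hvs, _, us, ⟨⟨N, θ⟩, hθ, rfl⟩, hN, hlt, hc⟩
    obtain rfl : (vs ++ us).length = N := hN
    let g : Fin (vs ++ us).length → Fin c.1 := fun j => ⟨(vs ++ us)[j], hlt _ (by simp)⟩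
    have hg : List.ofFn (fun j => (g j : ℕ)) = vs ++ us := List.ofFn_getElem
    refine ⟨θ.relabel g, ⟨hvs, ⟨_, θ⟩, hθ, g, ⟨us, hg.symm⟩, rfl⟩, ?_⟩
    rw [formulaCode_relabel g (g' := ((vs ++ us).getD · 0)) (fun j => ?_) (Φ.isQF i _ hθ), hc]
    simp [g, List.getElem?_eq_getElem j.2]

theorem rePred_exists_mem_instances (Φ : SigmaOneSeq L ι ar) (har : Computable ar) :
    REPred fun x : (ι × List ℕ) × FormulaCode L =>
      ∃ ψ ∈ Φ.instances x.2.1 x.1.1 x.1.2, formulaCode ⟨x.2.1, ψ⟩ = x.2 := by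
  let α := (((ι × List ℕ) × FormulaCode L) × FormulaCode L) × List ℕ
  have hlength : REPred fun x : (ι × List ℕ) × FormulaCode L => x.1.2.length = ar x.1.1 :=
    rePred_comp (f := fun x : (ι × List ℕ) × FormulaCode L => (x.1.2.length, ar x.1.1))
      Primrec.eq.computablePred.to_re
      ((Primrec.list_length.comp (Primrec.snd.comp Primrec.fst)).to_comp.pair
        (har.comp (Computable.fst.comp Computable.fst)))
  have hi : Primrec fun x : α => x.1.1.1.1 :=
    Primrec.fst.comp (Primrec.fst.comp (Primrec.fst.comp Primrec.fst))
  have hvars : Primrec fun x : α => x.1.1.1.2 ++ x.2 :=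
    Primrec.list_append.comp
      (Primrec.snd.comp (Primrec.fst.comp (Primrec.fst.comp Primrec.fst))) Primrec.snd
  have hcode : Primrec fun x : α => x.1.1.2 := Primrec.snd.comp (Primrec.fst.comp Primrec.fst)
  have hcode₀ : Primrec fun x : α => x.1.2 := Primrec.snd.comp Primrec.fst
  have hget : Primrec₂ fun (x : α) n => (x.1.1.1.2 ++ x.2).getD n 0 :=
    (Primrec.list_getD 0).comp (hvars.comp Primrec.fst) Primrec.snd
  have hinst : PrimrecPred fun x : α => (x.1.1.1.2 ++ x.2).length = x.1.2.1 ∧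
      (∀ u ∈ x.1.1.1.2 ++ x.2, u < x.1.1.2.1) ∧
        x.1.2.2.map (renameLetter ((x.1.1.1.2 ++ x.2).getD · 0)) = x.1.1.2.2 :=
    .and (Primrec.eq.comp (Primrec.list_length.comp hvars) (Primrec.fst.comp hcode₀))
      (.and (Primrec.nat_lt.forall_mem_list.comp hvars (Primrec.fst.comp hcode))
        (Primrec.eq.comp (Primrec.list_map (Primrec.snd.comp hcode₀) (primrec_renameLetter hget))
          (Primrec.snd.comp hcode)))
  refine (rePred_and hlength (rePred_exists (rePred_exists (rePred_and
    (rePred_comp Φ.ce (hi.pair hcode₀).to_comp) hinst.computablePred.to_re)))).of_eq fun x => ?_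
  rw [exists_mem_instances_iff]

theorem rePred_exists_conj_instances (Φ : SigmaOneSeq L ι ar) (har : Computable ar) {κ : Type*}
    [Primcodable κ] {S : κ → List (ι × List ℕ) → Prop}
    (hS : REPred fun x : κ × List (ι × List ℕ) => S x.1 x.2) :
    REPred fun x : κ × FormulaCode L => ∃ l : List ((ι × List ℕ) × L.Formula (Fin x.2.1)),
      S x.1 (l.map Prod.fst) ∧ (∀ a ∈ l, a.2 ∈ Φ.instances x.2.1 a.1.1 a.1.2) ∧
        formulaCode ⟨x.2.1, conj (l.map Prod.snd)⟩ = x.2 := by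
  let α := (κ × FormulaCode L) × List ((ι × List ℕ) × List (Letter L))
  have hl : Primrec fun x : α => x.2 := Primrec.snd
  have hN : Primrec fun x : α => x.1.2.1 := Primrec.fst.comp (Primrec.snd.comp Primrec.fst)
  have hSl : REPred fun x : α => S x.1.1 (x.2.map Prod.fst) :=
    rePred_comp hS ((Primrec.fst.comp Primrec.fst).pair
      (Primrec.list_map hl (Primrec.fst.comp Primrec.snd).to₂)).to_comp
  have hinst : REPred fun x : α => ∀ a ∈ x.2.map fun a => (a.1, (x.1.2.1, a.2)),
      ∃ ψ ∈ Φ.instances a.2.1 a.1.1 a.1.2, formulaCode ⟨a.2.1, ψ⟩ = a.2 :=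
    rePred_comp (rePred_forall_mem (Φ.rePred_exists_mem_instances har))
      (Primrec.list_map hl ((Primrec.fst.comp Primrec.snd).pair
        ((hN.comp Primrec.fst).pair (Primrec.snd.comp Primrec.snd))).to₂).to_comp
  have hconj : PrimrecPred fun x : α => conjCode (x.2.map Prod.snd) = x.1.2.2 :=
    Primrec.eq.comp (primrec_conjCode.comp
      (Primrec.list_map hl (Primrec.snd.comp Primrec.snd).to₂))
      (Primrec.snd.comp (Primrec.snd.comp Primrec.fst))
  refine (rePred_exists (rePred_and hSl (rePred_and hinst hconj.computablePred.to_re))).of_eq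
    fun x => ?_
  simp only [List.forall_mem_map]
  exact (exists_formulaCode_conj_iff
    (T := fun a : ι × List ℕ => Φ.instances x.2.1 a.1 a.2)).symm

/-- The disjoint union of two sequences of computable `Σ₁` formulas. -/
def sum {κ : Type w₂} [Primcodable κ] {ar' : κ → ℕ} (Φ : SigmaOneSeq L ι ar)
    (Ψ : SigmaOneSeq L κ ar') : SigmaOneSeq L (ι ⊕ κ) (Sum.elim ar ar') where
  disj := Sum.elim Φ.disj Ψ.disj
  ar_le := by
    rintro (i | i)
    exacts [Φ.ar_le i, Ψ.ar_le i]
  isQF := by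
    rintro (i | i)
    exacts [Φ.isQF i, Ψ.isQF i]
  ce := by
    have hinl : Computable fun x : ((ι ⊕ κ) × FormulaCode L) × ι => (x.2, x.1.2) :=
      Computable.snd.pair (Computable.snd.comp Computable.fst)
    have hinr : Computable fun x : ((ι ⊕ κ) × FormulaCode L) × κ => (x.2, x.1.2) :=
      Computable.snd.pair (Computable.snd.comp Computable.fst)
    refine (Partrec.sumCasesOn Computable.fst (rePred_comp Φ.ce hinl).to₂
      (rePred_comp Ψ.ce hinr).to₂).of_eq ?_
    rintro ⟨_ | _, _⟩ <;> rfl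

theorem realize_sum_inl {κ : Type w₂} [Primcodable κ] {ar' : κ → ℕ} {Φ : SigmaOneSeq L ι ar}
    {Ψ : SigmaOneSeq L κ ar'} {B : Type*} [L.Structure B] {i : ι} {x : List B} :
    (Φ.sum Ψ).Realize (.inl i) x ↔ Φ.Realize i x :=
  Iff.rfl

theorem realize_sum_inr {κ : Type w₂} [Primcodable κ] {ar' : κ → ℕ} {Φ : SigmaOneSeq L ι ar}
    {Ψ : SigmaOneSeq L κ ar'} {B : Type*} [L.Structure B] {k : κ} {x : List B} :
    (Φ.sum Ψ).Realize (.inr k) x ↔ Ψ.Realize k x :=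
  Iff.rfl

/-- The sequence of the formulas `⋁ ∃ ū ⋀ Φᵢ(v̄)`, where the finite conjunction runs over the pairs
`(i, v̄)` in a list `l`, the `v̄` being tuples of variables from among `x₀, …, x_{ar' j - 1}`
and `ū`, and the disjunction is over all `l` which satisfy `S j`. -/
def query (Φ : SigmaOneSeq L ι ar) (har : Computable ar) {κ : Type w₂} [Primcodable κ]
    {ar' : κ → ℕ} (har' : Computable ar') {S : κ → List (ι × List ℕ) → Prop}
    (hS : REPred fun x : κ × List (ι × List ℕ) => S x.1 x.2) : SigmaOneSeq L κ ar' where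
  disj j := {θ | ∃ (N : ℕ) (l : List ((ι × List ℕ) × L.Formula (Fin N))), ar' j ≤ N ∧
    S j (l.map Prod.fst) ∧ (∀ a ∈ l, a.2 ∈ Φ.instances N a.1.1 a.1.2) ∧
      θ = ⟨N, conj (l.map Prod.snd)⟩}
  ar_le := by
    rintro j _ ⟨N, l, hle, -, -, rfl⟩
    exact hle
  isQF := by
    rintro j _ ⟨N, l, -, -, hl, rfl⟩
    exact isQF_conj (List.forall_mem_map.2 fun a ha => isQF_of_mem_instances (hl a ha))
  ce := by
    have hle : REPred fun x : κ × FormulaCode L => ar' x.1 ≤ x.2.1 :=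
      rePred_comp (f := fun x : κ × FormulaCode L => (ar' x.1, x.2.1))
        Primrec.nat_le.computablePred.to_re
        ((har'.comp Computable.fst).pair (Computable.fst.comp Computable.snd))
    refine (rePred_and hle (Φ.rePred_exists_conj_instances har hS)).of_eq ?_
    rintro ⟨j, N, c⟩
    constructor
    · rintro ⟨hle, l, hS, hl, hc⟩
      exact ⟨_, ⟨N, l, hle, hS, hl, rfl⟩, hc⟩
    · rintro ⟨_, ⟨N, l, hle, hS, hl, rfl⟩, hc⟩
      obtain rfl : N = _ := congrArg Prod.fst hc
      exact ⟨hle, l, hS, hl, hc⟩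

theorem realize_query {Φ : SigmaOneSeq L ι ar} {har : Computable ar} {κ : Type w₂} [Primcodable κ]
    {ar' : κ → ℕ} {har' : Computable ar'} {S : κ → List (ι × List ℕ) → Prop}
    {hS : REPred fun x : κ × List (ι × List ℕ) => S x.1 x.2} {B : Type*} [L.Structure B] {j : κ}
    {x : List B} : (Φ.query har har' hS).Realize j x ↔ x.length = ar' j ∧
      ∃ l, S j l ∧ ∃ z, x <+: z ∧
        ∀ a ∈ l, (∀ v ∈ a.2, v < z.length) ∧ Φ.Realize a.1 (vals z a.2) := by
  refine and_congr_right fun hx => ⟨?_, ?_⟩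
  · rintro ⟨_, ⟨N, l, -, hS, hl, rfl⟩, w, hxw, hw⟩
    refine ⟨_, hS, _, hxw, List.forall_mem_map.2 fun a ha => ?_⟩
    rw [List.length_ofFn]
    exact realize_of_mem_instances (hl a ha)
      (realize_conj.1 hw _ (List.mem_map_of_mem ha))
  · rintro ⟨l, hS, z, hxz, hl⟩
    have hext : ∀ a ∈ l, ∃ t : List B, ∀ w, z <+: w → t ⊆ w →
        ∃ ψ ∈ Φ.instances w.length a.1 a.2, ψ.Realize w.get := fun a ha =>
      exists_realize_mem_instances (hl a ha).1 (hl a ha).2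
    choose! t ht using hext
    let w := z ++ l.flatMap t
    have hinst : ∀ a ∈ l, ∃ b : (ι × List ℕ) × L.Formula (Fin w.length), b.1 = a ∧
        (b.2 ∈ Φ.instances w.length b.1.1 b.1.2 ∧ b.2.Realize w.get) := fun a ha => by
      obtain ⟨ψ, hψ⟩ := ht a ha w (List.prefix_append ..) fun b hb =>
        List.mem_append_right _ (List.mem_flatMap.2 ⟨a, ha, hb⟩)
      exact ⟨(a, ψ), rfl, hψ⟩
    obtain ⟨l', hl'_eq, hl'⟩ := exists_map_eq_and_forall_mem_iff.2 hinst
    have hxw : x <+: List.ofFn w.get := by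
      rw [List.ofFn_get]
      exact hxz.trans (List.prefix_append ..)
    refine ⟨_, ⟨w.length, l', ?_, hl'_eq ▸ hS, fun a ha => (hl' a ha).1, rfl⟩, w.get, hxw, ?_⟩
    · simpa [hx] using hxw.length_le
    · exact realize_conj.2 (List.forall_mem_map.2 fun a ha => (hl' a ha).2)

end SigmaOneSeq

section Triples

variable {α β : Type*}

/-- Triples `(d̄, x̄, ȳ)` of tuples. A tuple `d̄x̄` of the interpretation without parameters
consists of parameters `d̄` and a tuple `x̄` of the interpretation with these parameters; `ȳ` is an
equivalent tuple of the interpretation with other parameters. -/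
abbrev Triple (α : Type*) := List α × List α × List α

/-- The tuple `d̄x̄` of a triple `(d̄, x̄, ȳ)`. -/
def Triple.head (t : Triple α) : List α :=
  t.1 ++ t.2.1

/-- The values of a triple of tuples of variables. -/
def Triple.vals (z : List β) (t : Triple ℕ) : Triple β :=
  (EffInt.vals z t.1, EffInt.vals z t.2.1, EffInt.vals z t.2.2)

theorem Triple.head_vals (z : List β) (t : Triple ℕ) :
    (t.vals z).head = EffInt.vals z t.head :=
  (vals_append ..).symm

theorem map_length_head_vals {z : List β} {ts : List (Triple ℕ)}
    (hts : ∀ t ∈ ts, ∀ v ∈ t.1 ++ t.2.1 ++ t.2.2, v < z.length) :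
    (ts.map (Triple.vals z)).map (fun t => t.head.length) = ts.map fun t => t.head.length := by
  rw [List.map_map]
  refine List.map_congr_left fun t ht => ?_
  rw [Function.comp_apply, Triple.head_vals]
  exact length_vals fun v hv => hts t ht v (List.mem_append_left _ hv)

theorem vals_flatMap (z : List β) (l : List α) (f : α → List ℕ) :
    vals z (l.flatMap f) = l.flatMap fun a => vals z (f a) := by
  induction l with
  | nil => rfl
  | cons a l ih => simp only [List.flatMap_cons, vals_append, ih]

theorem exists_triple_vals_eq {z pre : List β} (l : List (Triple β))
    (hhead : pre ++ l.flatMap Triple.head <+: z) (hy : ∀ t ∈ l, t.2.2 ⊆ z) :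
    ∃ ts : List (Triple ℕ), ts.map (Triple.vals z) = l ∧
      (∀ t ∈ ts, ∀ v ∈ t.1 ++ t.2.1 ++ t.2.2, v < z.length) ∧
      ts.flatMap Triple.head = List.range' pre.length (l.flatMap Triple.head).length := by
  induction l generalizing pre with
  | nil => exact ⟨[], by simp⟩
  | cons t l ih =>
    obtain ⟨d, x, y⟩ := t
    rw [List.forall_mem_cons] at hy
    have hdx : pre ++ d ++ x ++ l.flatMap Triple.head <+: z := by
      simpa [Triple.head] using hhead
    obtain ⟨ts, rfl, hlt, hts⟩ := ih hdx hy.2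
    obtain ⟨vy, rfl, hvy⟩ := exists_vals_eq hy.1
    have hx : pre ++ d ++ x <+: z := (List.prefix_append ..).trans hdx
    have hd : pre ++ d <+: z := (List.prefix_append ..).trans hx
    have hle := hx.length_le
    simp only [List.length_append] at hle
    refine ⟨(List.range' pre.length d.length, List.range' (pre ++ d).length x.length, vy) :: ts,
      ?_, List.forall_mem_cons.2 ⟨?_, hlt⟩, ?_⟩
    · simp only [List.map_cons, Triple.vals, vals_range' hd, vals_range' hx]
    · simp only [List.forall_mem_append, List.mem_range'_1, List.length_append]
      exact ⟨⟨fun v hv => by omega, fun v hv => by omega⟩, hvy⟩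
    · simp only [List.flatMap_cons, hts, Triple.head, List.length_append, ← List.range'_append_1,
        List.append_assoc, Nat.add_assoc]

end Triples

section TransferAtoms

variable {ι : Type w₁}

/-- The indices of the formulas that occur in `transfer`, namely `φ`, the instances of `dom`, those
of `F` and those of `Θ`. -/
abbrev TransferIndex (ι : Type w₁) : Type w₁ :=
  Unit ⊕ (Unit × List ℕ) ⊕ (Unit × List ℕ) ⊕ (ι × List ℕ)

/-- The conjuncts `φ(c̄)`, `Θ(c̄; ȳ₁, …, ȳ_k)` and, for each `j`, `φ(d̄_j)`, `dom(d̄_j; x̄_j)` and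
`F(d̄_j, c̄, x̄_j, ȳ_j)` of `transfer`. They are used both for tuples of variables and
for tuples of their values. -/
def transferAtoms {α : Type*} (i : ι) (c : List α) (l : List (Triple α)) :
    List (TransferIndex ι × List α) :=
  (.inl (), c) ::
    (.inr (.inr (.inr (i, l.map fun t => t.2.2.length))), c ++ l.flatMap fun t => t.2.2) ::
    l.flatMap fun t => [(.inl (), t.1), (.inr (.inl ((), [t.2.1.length])), t.head),
      (.inr (.inr (.inl ((), [t.1.length, c.length, t.2.1.length, t.2.2.length]))),
        t.1 ++ c ++ t.2.1 ++ t.2.2)]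

theorem forall_mem_transferAtoms_lt_iff {i : ι} {c : List ℕ} {ts : List (Triple ℕ)} {N : ℕ} :
    (∀ a ∈ transferAtoms i c ts, ∀ v ∈ a.2, v < N) ↔
      (∀ v ∈ c, v < N) ∧ ∀ t ∈ ts, ∀ v ∈ t.1 ++ t.2.1 ++ t.2.2, v < N := by
  simp only [transferAtoms, Triple.head, List.forall_mem_cons, List.forall_mem_flatMap,
    List.forall_mem_append, List.not_mem_nil, IsEmpty.forall_iff, implies_true, and_true]
  grind

theorem map_transferAtoms_vals {β : Type*} {i : ι} {c : List ℕ} {ts : List (Triple ℕ)} {z : List β}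
    (hc : ∀ v ∈ c, v < z.length)
    (hts : ∀ t ∈ ts, ∀ v ∈ t.1 ++ t.2.1 ++ t.2.2, v < z.length) :
    (transferAtoms i c ts).map (Prod.map id (vals z)) =
      transferAtoms i (vals z c) (ts.map (Triple.vals z)) := by
  have hlen : ∀ t ∈ ts, (vals z t.1).length = t.1.length ∧
      (vals z t.2.1).length = t.2.1.length ∧ (vals z t.2.2).length = t.2.2.length := by
    intro t ht
    have h := hts t ht
    simp only [List.forall_mem_append] at h
    exact ⟨length_vals h.1.1, length_vals h.1.2, length_vals h.2⟩
  have hy : ts.map (fun t => (vals z t.2.2).length) = ts.map fun t => t.2.2.length :=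
    List.map_congr_left fun t ht => (hlen t ht).2.2
  simp only [transferAtoms, List.map_cons, List.map_flatMap, List.flatMap_map, List.map_map,
    Function.comp_def, Prod.map, id, vals_append, vals_flatMap, Triple.vals, Triple.head, hy,
    length_vals hc, List.map_nil]
  congr 2
  refine List.flatMap_congr fun t ht => ?_
  rw [(hlen t ht).1, (hlen t ht).2.1, (hlen t ht).2.2]

theorem primrec_transferAtoms [Primcodable ι] :
    Primrec fun x : ι × List ℕ × List (Triple ℕ) => transferAtoms x.1 x.2.1 x.2.2 := by
  let α := (ι × List ℕ × List (Triple ℕ)) × Triple ℕ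
  have hc : Primrec fun x : ι × List ℕ × List (Triple ℕ) => x.2.1 := Primrec.fst.comp Primrec.snd
  have hts : Primrec fun x : ι × List ℕ × List (Triple ℕ) => x.2.2 :=
    Primrec.snd.comp Primrec.snd
  have hd : Primrec fun x : α => x.2.1 := Primrec.fst.comp Primrec.snd
  have hx : Primrec fun x : α => x.2.2.1 := Primrec.fst.comp (Primrec.snd.comp Primrec.snd)
  have hy : Primrec fun x : α => x.2.2.2 := Primrec.snd.comp (Primrec.snd.comp Primrec.snd)
  have hlen {σ : Type _} [Primcodable σ] {f : σ → List ℕ} (hf : Primrec f) :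
      Primrec fun a => (f a).length := Primrec.list_length.comp hf
  have hΘ : Primrec fun x : ι × List ℕ × List (Triple ℕ) =>
      ((.inr (.inr (.inr (x.1, x.2.2.map fun t => t.2.2.length))),
        x.2.1 ++ x.2.2.flatMap fun t => t.2.2) : TransferIndex ι × List ℕ) :=
    (Primrec.sumInr.comp (Primrec.sumInr.comp (Primrec.sumInr.comp
      (Primrec.fst.pair (Primrec.list_map hts (hlen hy).to₂))))).pair
      (Primrec.list_append.comp hc (Primrec.list_flatMap hts hy.to₂))
  have hdom : Primrec fun x : α =>
      ((.inr (.inl ((), [x.2.2.1.length])), x.2.head) : TransferIndex ι × List ℕ) :=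
    (Primrec.sumInr.comp (Primrec.sumInl.comp ((Primrec.const ()).pair
      (Primrec.list_cons.comp (hlen hx) (Primrec.const []))))).pair
      (Primrec.list_append.comp hd hx)
  have hF : Primrec fun x : α => ((.inr (.inr (.inl ((),
      [x.2.1.length, x.1.2.1.length, x.2.2.1.length, x.2.2.2.length]))),
      x.2.1 ++ x.1.2.1 ++ x.2.2.1 ++ x.2.2.2) : TransferIndex ι × List ℕ) :=
    (Primrec.sumInr.comp (Primrec.sumInr.comp (Primrec.sumInl.comp ((Primrec.const ()).pair
      (Primrec.list_cons.comp (hlen hd) (Primrec.list_cons.comp (hlen (hc.comp Primrec.fst))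
        (Primrec.list_cons.comp (hlen hx) (Primrec.list_cons.comp (hlen hy)
          (Primrec.const []))))))))).pair
      (Primrec.list_append.comp (Primrec.list_append.comp (Primrec.list_append.comp
        hd (hc.comp Primrec.fst)) hx) hy)
  exact Primrec.list_cons.comp ((Primrec.const _).pair hc) (Primrec.list_cons.comp hΘ
    (Primrec.list_flatMap hts (Primrec.list_cons.comp ((Primrec.const _).pair hd)
      (Primrec.list_cons.comp hdom (Primrec.list_cons.comp hF (Primrec.const [])))).to₂))

end TransferAtoms

section Transfer

theorem exists_ofFn_eq {α : Type*} {l : List α} {n : ℕ} (h : l.length = n) :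
    ∃ f : Fin n → α, List.ofFn f = l := by
  subst h
  exact ⟨l.get, l.ofFn_get⟩

theorem primrec_list_sum : Primrec (List.sum : List ℕ → ℕ) := by
  have hadd : Primrec₂ fun (_ : List ℕ) (x : ℕ × ℕ) => x.1 + x.2 :=
    (Primrec.nat_add.comp Primrec.fst Primrec.snd).comp Primrec.snd
  exact (Primrec.list_foldr Primrec.id (Primrec.const 0) hadd).of_eq
    fun _ => List.sum_eq_foldr.symm

theorem computable_sumElim {α β γ : Type*} [Primcodable α] [Primcodable β] [Primcodable γ]
    {f : α → γ} {g : β → γ} (hf : Computable f) (hg : Computable g) :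
    Computable (Sum.elim f g) :=
  (Computable.sumCasesOn Computable.id (hf.comp Computable.snd).to₂
    (hg.comp Computable.snd).to₂).of_eq fun x => by cases x <;> rfl

theorem computable_genArity {ι : Type w₁} [Primcodable ι] (p : ℕ) :
    Computable fun s : ι × List ℕ => p + s.2.sum :=
  (Primrec.nat_add.comp (Primrec.const p) (primrec_list_sum.comp Primrec.snd)).to_comp

/-- `l` is the list of the conjuncts of `transfer` for some tuples of variables such that the
concatenation of the tuples `d̄_j x̄_j`, of lengths `j.2`, is `x₀, x₁, …`. -/
def IsTransferAtoms {ι : Type w₁} (j : ι × List ℕ) (l : List (TransferIndex ι × List ℕ)) : Prop :=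
  ∃ s : List ℕ × List (Triple ℕ), s.2.map (fun t => t.head.length) = j.2 ∧
    s.2.flatMap Triple.head = List.range j.2.sum ∧ transferAtoms j.1 s.1 s.2 = l

theorem rePred_isTransferAtoms (ι : Type w₁) [Primcodable ι] :
    REPred fun x : (ι × List ℕ) × List (TransferIndex ι × List ℕ) => IsTransferAtoms x.1 x.2 := by
  let α := ((ι × List ℕ) × List (TransferIndex ι × List ℕ)) × List ℕ × List (Triple ℕ)
  have hi : Primrec fun x : α => x.1.1.1 := Primrec.fst.comp (Primrec.fst.comp Primrec.fst)
  have hns : Primrec fun x : α => x.1.1.2 := Primrec.snd.comp (Primrec.fst.comp Primrec.fst)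
  have hts : Primrec fun x : α => x.2.2 := Primrec.snd.comp Primrec.snd
  have hhead : Primrec (Triple.head : Triple ℕ → List ℕ) :=
    Primrec.list_append.comp Primrec.fst (Primrec.fst.comp Primrec.snd)
  have hlength : PrimrecPred fun x : α => x.2.2.map (fun t => t.head.length) = x.1.1.2 :=
    Primrec.eq.comp
      (Primrec.list_map hts (Primrec.list_length.comp (hhead.comp Primrec.snd)).to₂) hns
  have hrange : PrimrecPred fun x : α => x.2.2.flatMap Triple.head = List.range x.1.1.2.sum :=
    Primrec.eq.comp (Primrec.list_flatMap hts (hhead.comp Primrec.snd).to₂)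
      (Primrec.list_range.comp (primrec_list_sum.comp hns))
  have hatoms : PrimrecPred fun x : α => transferAtoms x.1.1.1 x.2.1 x.2.2 = x.1.2 :=
    Primrec.eq.comp (primrec_transferAtoms.comp (hi.pair Primrec.snd))
      (Primrec.snd.comp Primrec.fst)
  exact rePred_exists (hlength.and (hrange.and hatoms)).computablePred.to_re

variable {L : FirstOrder.Language.{u₁, v₁}} [ComputableLanguage L] {ι : Type w₁} [Primcodable ι]
  {p : ℕ}

/-- The formulas which say of `z̄₁, …, z̄_k` that `z̄_j = d̄_j x̄_j` with `φ(d̄_j)` and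
`dom(d̄_j; x̄_j)`, and that there are `c̄` and `ȳ₁, …, ȳ_k` such that `φ(c̄)`,
`F(d̄_j, c̄, x̄_j, ȳ_j)` and `Θ(c̄; ȳ₁, …, ȳ_k)`. -/
def transfer (φ : SigmaOneFormula L p) (dom : GenSigmaOneSeq L Unit p)
    (F : GenSigmaOneSeq L Unit 0) (Θ : GenSigmaOneSeq L ι p) : GenSigmaOneSeq L ι 0 :=
  (φ.sum (dom.sum (F.sum Θ))).query
    (computable_sumElim (Computable.const p) (computable_sumElim (computable_genArity p)
      (computable_sumElim (computable_genArity 0) (computable_genArity p))))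
    (computable_genArity 0) (rePred_isTransferAtoms ι)

variable {φ : SigmaOneFormula L p} {dom : GenSigmaOneSeq L Unit p} {F : GenSigmaOneSeq L Unit 0}
  {Θ : GenSigmaOneSeq L ι p} {B : Type w₂} [L.Structure B] {i : ι}

theorem realize_transfer_iff {ns : List ℕ} {w : List B} :
    (transfer φ dom F Θ).Realize (i, ns) w ↔ ∃ (c : List B) (l : List (Triple B)),
      l.map (fun t => t.head.length) = ns ∧ l.flatMap Triple.head = w ∧
        ∀ a ∈ transferAtoms i c l, (φ.sum (dom.sum (F.sum Θ))).Realize a.1 a.2 := by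
  rw [transfer, SigmaOneSeq.realize_query]
  constructor
  · rintro ⟨hw, _, ⟨⟨vc, ts⟩, hns, hrange, rfl⟩, z, hwz, hz⟩
    obtain ⟨hlt, hz⟩ := forall₂_and.1 hz
    obtain ⟨hc, hts⟩ := forall_mem_transferAtoms_lt_iff.1 hlt
    refine ⟨vals z vc, ts.map (Triple.vals z), ?_, ?_, ?_⟩
    · rw [map_length_head_vals hts, hns]
    · simp only [List.flatMap_map, Triple.head_vals]
      rw [← vals_flatMap, hrange, ← Nat.zero_add (List.sum _), ← hw, List.range_eq_range']
      exact vals_range' (pre := []) hwz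
    · rw [← map_transferAtoms_vals hc hts]
      exact List.forall_mem_map.2 hz
  · rintro ⟨c, l, rfl, rfl, hl⟩
    let z := l.flatMap Triple.head ++ (c ++ l.flatMap fun t => t.2.2)
    have hcz : c ⊆ z := fun a ha => by simp [z, ha]
    have hyz : ∀ t ∈ l, t.2.2 ⊆ z := fun t ht a ha => by
      simp only [z, List.mem_append, List.mem_flatMap]
      exact .inr (.inr ⟨t, ht, ha⟩)
    have hwz : l.flatMap Triple.head <+: z := List.prefix_append ..
    obtain ⟨vc, hvc, hc⟩ := exists_vals_eq hcz
    obtain ⟨ts, hts_eq, hts, hrange⟩ := exists_triple_vals_eq (pre := []) l hwz hyz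
    refine ⟨by simp [List.length_flatMap], _, ⟨(vc, ts), ?_, ?_, rfl⟩, z, hwz, ?_⟩
    · rw [← hts_eq, map_length_head_vals hts]
    · rw [hrange, List.length_nil, ← List.range_eq_range', List.length_flatMap]
    · refine forall₂_and.2 ⟨forall_mem_transferAtoms_lt_iff.2 ⟨hc, hts⟩, ?_⟩
      rw [← hvc, ← hts_eq, ← map_transferAtoms_vals hc hts] at hl
      exact List.forall_mem_map.1 hl

theorem forall_mem_transferAtoms_realize_iff {c : Fin p → B} {l : List (Triple B)} :
    (∀ a ∈ transferAtoms i (List.ofFn c) l,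
        (φ.sum (dom.sum (F.sum Θ))).Realize a.1 a.2) ↔
      φ.Realize () (List.ofFn c) ∧ GenHolds Θ i c (l.map fun t => t.2.2) ∧
        ∀ t ∈ l, ∃ d : Fin p → B, t.1 = List.ofFn d ∧ φ.Realize () (List.ofFn d) ∧
          GenHolds dom () d [t.2.1] ∧ quaternary F d c t.2.1 t.2.2 := by
  simp only [transferAtoms, List.forall_mem_cons, List.forall_mem_flatMap, List.not_mem_nil,
    IsEmpty.forall_iff, implies_true, and_true, SigmaOneSeq.realize_sum_inl,
    SigmaOneSeq.realize_sum_inr, Triple.head]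
  refine and_congr Iff.rfl (and_congr ?_ (forall₂_congr fun t _ => ?_))
  · rw [GenHolds, List.map_map, ← List.flatMap_def]
    rfl
  · obtain ⟨d, x, y⟩ := t
    constructor
    · rintro ⟨hd, hx, hF⟩
      obtain ⟨d, rfl⟩ := exists_ofFn_eq hd.1
      refine ⟨d, rfl, hd, ?_, ?_⟩
      · simpa [GenHolds] using hx
      · simpa [quaternary, GenHolds] using hF
    · rintro ⟨d, rfl, hd, hx, hF⟩
      refine ⟨hd, ?_, ?_⟩
      · simpa [GenHolds] using hx
      · simpa [quaternary, GenHolds] using hF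

theorem genHolds_transfer_iff {k : ℕ} {zs : Fin k → List B} :
    GenHolds (transfer φ dom F Θ) i (Fin.elim0 : Fin 0 → B) (List.ofFn zs) ↔
      ∃ (c : Fin p → B) (d : Fin k → Fin p → B) (x y : Fin k → List B),
        φ.Realize () (List.ofFn c) ∧ GenHolds Θ i c (List.ofFn y) ∧
          ∀ j, zs j = List.ofFn (d j) ++ x j ∧ φ.Realize () (List.ofFn (d j)) ∧
            GenHolds dom () (d j) [x j] ∧ quaternary F (d j) c (x j) (y j) := by
  rw [GenHolds, realize_transfer_iff]
  constructor
  · rintro ⟨c, l, hlen, hflat, hl⟩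
    have hc : φ.Realize () c := hl _ List.mem_cons_self
    obtain ⟨c, rfl⟩ := exists_ofFn_eq hc.1
    obtain ⟨-, hΘ, hl⟩ := forall_mem_transferAtoms_realize_iff.1 hl
    obtain ⟨t, rfl⟩ := exists_ofFn_eq (l := l) (n := k) (by simpa using congrArg List.length hlen)
    choose d hd using fun j => hl (t j) (List.mem_ofFn.2 ⟨j, rfl⟩)
    have hzs : List.ofFn zs = (List.ofFn t).map Triple.head :=
      List.eq_iff_flatten_eq.2 ⟨by simpa [List.flatMap_def] using hflat.symm,
        by simpa [Function.comp_def] using hlen.symm⟩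
    rw [List.map_ofFn, List.ofFn_inj] at hzs
    refine ⟨c, d, fun j => (t j).2.1, fun j => (t j).2.2, hc, ?_, fun j => ⟨?_, (hd j).2⟩⟩
    · simpa [List.map_ofFn, Function.comp_def] using hΘ
    · rw [hzs, ← (hd j).1]
      rfl
  · rintro ⟨c, d, x, y, hc, hΘ, h⟩
    obtain rfl : zs = fun j => List.ofFn (d j) ++ x j := funext fun j => (h j).1
    refine ⟨List.ofFn c, List.ofFn fun j => (List.ofFn (d j), x j, y j), ?_, ?_,
      forall_mem_transferAtoms_realize_iff.2 ⟨hc, ?_, ?_⟩⟩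
    · simp [List.map_ofFn, Function.comp_def, Triple.head]
    · simp [List.flatMap_def, List.map_ofFn, Function.comp_def, Triple.head]
    · simpa [List.map_ofFn, Function.comp_def] using hΘ
    · rw [List.forall_mem_ofFn_iff]
      exact fun j => ⟨d j, rfl, (h j).2⟩

end Transfer

section Pullbacks

variable {L : FirstOrder.Language.{u₁, v₁}} [ComputableLanguage L] {ι : Type w₁} [Primcodable ι]
  {B : Type w₂} [L.Structure B] {A : Type*} {p k : ℕ}

/-- The formula `Θ i` with parameters `c` defines the preimage of the relation `T` on `A` under the
partial map with graph `G` from the finite tuples to `A`. -/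
def DefinesPullback (Θ : GenSigmaOneSeq L ι p) (i : ι) (c : Fin p → B) (G : List B → A → Prop)
    (T : (Fin k → A) → Prop) : Prop :=
  ∀ xs : Fin k → List B,
    GenHolds Θ i c (List.ofFn xs) ↔ ∃ as : Fin k → A, (∀ j, G (xs j) (as j)) ∧ T as

theorem definesPullback_one_iff {Θ : GenSigmaOneSeq L ι p} {i : ι} {c : Fin p → B}
    {G : List B → A → Prop} {T : (Fin 1 → A) → Prop} :
    DefinesPullback Θ i c G T ↔ ∀ x, GenHolds Θ i c [x] ↔ ∃ a, G x a ∧ T ![a] := by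
  simp only [DefinesPullback, Fin.forall_fin_succ_pi, Fin.forall_fin_zero_pi,
    Fin.exists_fin_succ_pi, Fin.exists_fin_zero_pi, Fin.forall_fin_one, Fin.cons_zero]
  rfl

theorem definesPullback_two_iff {Θ : GenSigmaOneSeq L ι p} {i : ι} {c : Fin p → B}
    {G : List B → A → Prop} {T : (Fin 2 → A) → Prop} :
    DefinesPullback Θ i c G T ↔
      ∀ x y, GenHolds Θ i c [x, y] ↔ ∃ a b, G x a ∧ G y b ∧ T ![a, b] := by
  simp only [DefinesPullback, Fin.forall_fin_succ_pi, Fin.forall_fin_zero_pi,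
    Fin.exists_fin_succ_pi, Fin.exists_fin_zero_pi, Fin.forall_fin_two, Fin.cons_zero,
    Fin.cons_one, and_assoc]
  rfl

theorem DefinesPullback.congr {Θ : GenSigmaOneSeq L ι p} {i : ι} {c : Fin p → B}
    {G : List B → A → Prop} {T : (Fin k → A) → Prop} (h : DefinesPullback Θ i c G T)
    {xs ys : Fin k → List B} (hxy : ∀ j a, G (xs j) a ↔ G (ys j) a) :
    GenHolds Θ i c (List.ofFn xs) ↔ GenHolds Θ i c (List.ofFn ys) := by
  rw [h xs, h ys]
  simp only [hxy]

theorem DefinesPullback.compl_iff {Θ Θ' : GenSigmaOneSeq L ι p} {i : ι} {c : Fin p → B}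
    {G : List B → A → Prop} {T : (Fin k → A) → Prop}
    (h' : DefinesPullback Θ' i c G fun as => ¬ T as) (h : DefinesPullback Θ i c G T)
    (hG : Relator.RightUnique G) (xs : Fin k → List B) :
    GenHolds Θ' i c (List.ofFn xs) ↔
      (∀ j, ∃ a, G (xs j) a) ∧ ¬ GenHolds Θ i c (List.ofFn xs) := by
  rw [h' xs, h xs]
  constructor
  · rintro ⟨as, has, hT⟩
    refine ⟨fun j => ⟨_, has j⟩, fun ⟨as', has', hT'⟩ => hT ?_⟩
    rwa [show as = as' from funext fun j => hG (has j) (has' j)]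
  · rintro ⟨hdom, hT⟩
    choose as has using hdom
    exact ⟨as, has, fun hT' => hT ⟨as, has, hT'⟩⟩

/-- The union over `c ∈ S` of the partial maps with graphs `G c`, the domains of which are made
disjoint by prefixing `c`. -/
def Pooled {S : Set (Fin p → B)} (G : S → List B → A → Prop) (z : List B) (a : A) : Prop :=
  ∃ (c : S) (x : List B), z = List.ofFn c.1 ++ x ∧ G c x a

theorem rightUnique_pooled {S : Set (Fin p → B)} {G : S → List B → A → Prop}
    (hG : ∀ c, Relator.RightUnique (G c)) : Relator.RightUnique (Pooled G) := by
  rintro _ a a' ⟨c, x, rfl, ha⟩ ⟨d, y, hz, ha'⟩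
  obtain ⟨hcd, rfl⟩ := List.append_inj hz (by simp)
  obtain rfl : c = d := Subtype.ext (List.ofFn_injective hcd)
  exact hG c ha ha'

theorem rightTotal_pooled {S : Set (Fin p → B)} {G : S → List B → A → Prop} (c : S)
    (hG : Relator.RightTotal (G c)) : Relator.RightTotal (Pooled G) := fun a =>
  let ⟨x, hx⟩ := hG a
  ⟨_, c, x, rfl, hx⟩

theorem DefinesPullback.transfer {S : Set (Fin p → B)} {G : S → List B → A → Prop}
    {φ : SigmaOneFormula L p} (hφ : ∀ c : Fin p → B, φ.Realize () (List.ofFn c) ↔ c ∈ S)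
    {dom : GenSigmaOneSeq L Unit p}
    (hdom : ∀ c : S, DefinesPullback dom () c.1 (G c) fun _ : Fin 1 → A => True)
    {F : GenSigmaOneSeq L Unit 0}
    (hF : ∀ (c d : S) (x y : List B) (a b : A), G c x a → G d y b →
      (quaternary F c.1 d.1 x y ↔ a = b))
    (c₀ : S) (hG : Relator.RightTotal (G c₀)) {Θ : GenSigmaOneSeq L ι p} {i : ι}
    {T : (Fin k → A) → Prop} (hΘ : ∀ c : S, DefinesPullback Θ i c.1 (G c) T) :
    DefinesPullback (transfer φ dom F Θ) i (Fin.elim0 : Fin 0 → B) (Pooled G) T := by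
  simp only [definesPullback_one_iff, and_true] at hdom
  intro zs
  rw [genHolds_transfer_iff]
  constructor
  · rintro ⟨c, d, x, y, hc, hy, h⟩
    rw [hφ] at hc
    simp only [hφ] at h
    obtain ⟨as, hya, hT⟩ := (hΘ ⟨c, hc⟩ y).1 hy
    refine ⟨as, fun j => ?_, hT⟩
    obtain ⟨hz, hd, hx, hxy⟩ := h j
    obtain ⟨a, hxa⟩ := (hdom ⟨d j, hd⟩ (x j)).1 hx
    obtain rfl := (hF ⟨d j, hd⟩ ⟨c, hc⟩ _ _ _ _ hxa (hya j)).1 hxy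
    exact ⟨_, x j, hz, hxa⟩
  · rintro ⟨as, hz, hT⟩
    choose d x hz hxa using hz
    choose y hya using fun j => hG (as j)
    exact ⟨c₀, fun j => d j, x, y, (hφ _).2 c₀.2, (hΘ c₀ y).2 ⟨as, hya, hT⟩, fun j =>
      ⟨hz j, (hφ _).2 (d j).2, (hdom _ _).2 ⟨_, hxa j⟩, (hF _ _ _ _ _ _ (hxa j) (hya j)).2 rfl⟩⟩

end Pullbacks

section Automorphisms

variable {L : FirstOrder.Language.{u₁, v₁}} [ComputableLanguage L] {ι : Type w₁} [Primcodable ι]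
  {B : Type w₂} [L.Structure B] {p : ℕ}

theorem SigmaOneSeq.Realize.map_equiv {ar : ι → ℕ} {Φ : SigmaOneSeq L ι ar} {i : ι} {x : List B}
    (h : Φ.Realize i x) (σ : B ≃[L] B) : Φ.Realize i (x.map σ) := by
  obtain ⟨hx, θ, hθ, v, hv, hr⟩ := h
  refine ⟨by simpa using hx, θ, hθ, σ ∘ v, ?_, (StrongHomClass.realize_formula σ θ.2).2 hr⟩
  rw [← List.map_ofFn]
  exact hv.map σ

theorem GenHolds.map_equiv {Θ : GenSigmaOneSeq L ι p} {i : ι} {c : Fin p → B}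
    {xs : List (List B)} (h : GenHolds Θ i c xs) (σ : B ≃[L] B) :
    GenHolds Θ i (σ ∘ c) (xs.map (List.map σ)) := by
  have := SigmaOneSeq.Realize.map_equiv h σ
  rw [List.map_append, List.map_ofFn, List.map_flatten] at this
  simpa [GenHolds, Function.comp_def] using this

theorem genHolds_comp_equiv_iff {Θ : GenSigmaOneSeq L ι p} {i : ι} {b : Fin p → B}
    {σ : B ≃[L] B} {xs : List (List B)} :
    GenHolds Θ i (σ ∘ b) xs ↔ GenHolds Θ i b (xs.map (List.map σ.symm)) := by
  constructor <;> intro h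
  · simpa [← Function.comp_assoc, Function.comp_def] using h.map_equiv σ.symm
  · simpa [Function.comp_def] using h.map_equiv σ

theorem DefinesPullback.comp_equiv {A : Type*} {k : ℕ} {Θ : GenSigmaOneSeq L ι p} {i : ι}
    {b : Fin p → B} {G : List B → A → Prop} {T : (Fin k → A) → Prop}
    (h : DefinesPullback Θ i b G T) (σ : B ≃[L] B) :
    DefinesPullback Θ i (σ ∘ b) (fun x => G (x.map σ.symm)) T := fun xs => by
  rw [genHolds_comp_equiv_iff, List.map_ofFn]
  exact h _

end Automorphisms

namespace InterpFormulas

variable {LA : FirstOrder.Language.{u₁, v₁}} {LB : FirstOrder.Language.{u₂, v₂}}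
  [ComputableLanguage LA] [ComputableLanguage LB] {p : ℕ} {Φ : InterpFormulas LA LB p}
  {B : Type w₂} [LB.Structure B] {A : Type w₁} {c : Fin p → B}

/-- The graph of the partial map which takes a tuple `x ∈ D_c̄` to the image of its class under
`e`. -/
def ClassGraph (Φ : InterpFormulas LA LB p) (c : Fin p → B) (e : Φ.Model c → A) (x : List B)
    (a : A) : Prop :=
  ∃ hx : x ∈ Φ.D c, e (Φ.cls c ⟨x, hx⟩) = a

theorem rightUnique_classGraph {e : Φ.Model c → A} : Relator.RightUnique (Φ.ClassGraph c e) := by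
  rintro x _ _ ⟨_, rfl⟩ ⟨_, rfl⟩
  rfl

theorem rightTotal_classGraph {e : Φ.Model c → A} (he : Function.Surjective e) :
    Relator.RightTotal (Φ.ClassGraph c e) := fun a => by
  obtain ⟨⟨x⟩, rfl⟩ := he a
  exact ⟨x, x.2, rfl⟩

theorem definesPullback_classGraph {ι : Type*} [Primcodable ι] {k : ℕ}
    {Θ : GenSigmaOneSeq LB ι p} {i : ι} {e : Φ.Model c → A} {T : (Fin k → A) → Prop}
    (hdom : ∀ xs : Fin k → List B, GenHolds Θ i c (List.ofFn xs) → ∀ j, xs j ∈ Φ.D c)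
    (hT : ∀ xs : Fin k → Φ.D c, T (fun j => e (Φ.cls c (xs j))) ↔
      GenHolds Θ i c (List.ofFn fun j => (xs j : List B))) :
    DefinesPullback Θ i c (Φ.ClassGraph c e) T := fun xs => by
  constructor
  · intro h
    exact ⟨_, fun j => ⟨hdom xs h j, rfl⟩, (hT fun j => ⟨xs j, hdom xs h j⟩).2 h⟩
  · rintro ⟨as, has, h⟩
    choose hxs has using has
    obtain rfl := funext has
    exact (hT fun j => ⟨xs j, hxs j⟩).1 h

variable [LA.Structure A]

/-- The formulas with parameters `c` define the preimages of the universe, of equality, of the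
relations of `A` and of the complements of these under the partial map with graph `G` from the
finite tuples to `A`. If `G` is the graph of a surjective partial map, this is an effective
interpretation, see `Presents.interprets`. -/
structure Presents (Φ : InterpFormulas LA LB p) (c : Fin p → B) (G : List B → A → Prop) :
    Prop where
  dom : DefinesPullback Φ.dom () c G fun _ : Fin 1 → A => True
  eqv : DefinesPullback Φ.eqv () c G fun as : Fin 2 → A => as 0 = as 1
  neqv : DefinesPullback Φ.neqv () c G fun as : Fin 2 → A => as 0 ≠ as 1
  rel : ∀ {n : ℕ} (R : LA.Relations n), DefinesPullback Φ.rel ⟨n, R⟩ c G (Structure.RelMap R)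
  nrel : ∀ {n : ℕ} (R : LA.Relations n),
    DefinesPullback Φ.nrel ⟨n, R⟩ c G fun as : Fin n → A => ¬ Structure.RelMap R as

namespace Presents

variable {G : List B → A → Prop}

theorem comp_equiv (h : Φ.Presents c G) (σ : B ≃[LB] B) :
    Φ.Presents (σ ∘ c) fun x => G (x.map σ.symm) where
  dom := h.dom.comp_equiv σ
  eqv := h.eqv.comp_equiv σ
  neqv := h.neqv.comp_equiv σ
  rel R := (h.rel R).comp_equiv σ
  nrel R := (h.nrel R).comp_equiv σ

theorem mem_D_iff (h : Φ.Presents c G) {x : List B} : x ∈ Φ.D c ↔ ∃ a, G x a := by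
  exact (definesPullback_one_iff.1 h.dom x).trans (by simp only [and_true])

theorem eqv_iff (h : Φ.Presents c G) {x y : List B} : Φ.Eqv c x y ↔ ∃ a, G x a ∧ G y a := by
  exact (definesPullback_two_iff.1 h.eqv x y).trans (by simp)

theorem neqv_iff (h : Φ.Presents c G) (hG : Relator.RightUnique G) {x y : List B} :
    Φ.Neqv c x y ↔ x ∈ Φ.D c ∧ y ∈ Φ.D c ∧ ¬ Φ.Eqv c x y := by
  rw [← and_assoc, h.mem_D_iff, h.mem_D_iff]
  exact (h.neqv.compl_iff h.eqv hG ![x, y]).trans (and_congr_left' Fin.forall_fin_two)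

theorem nrel_iff (h : Φ.Presents c G) (hG : Relator.RightUnique G) {n : ℕ} (R : LA.Relations n)
    (xs : Fin n → List B) :
    Φ.Nrel c R xs ↔ (∀ j, xs j ∈ Φ.D c) ∧ ¬ Φ.Rel c R xs := by
  simp only [h.mem_D_iff]
  exact (h.nrel R).compl_iff (h.rel R) hG xs

theorem rel_congr (h : Φ.Presents c G) (hG : Relator.RightUnique G) {n : ℕ} (R : LA.Relations n)
    {xs ys : Fin n → List B} (hxy : ∀ j, Φ.Eqv c (xs j) (ys j)) :
    Φ.Rel c R xs ↔ Φ.Rel c R ys :=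
  (h.rel R).congr fun j a => by
    obtain ⟨a', hx, hy⟩ := h.eqv_iff.1 (hxy j)
    exact ⟨fun ha => hG hx ha ▸ hy, fun ha => hG hy ha ▸ hx⟩

end Presents

section Relational

variable [LA.IsRelational]

theorem nonempty_model_equiv {g : Φ.D c → A} (hg : Function.Surjective g)
    (hE : ∀ x y : Φ.D c, Φ.Eqv c x y ↔ g x = g y)
    (hR : ∀ {n : ℕ} (R : LA.Relations n) (xs : Fin n → Φ.D c),
      Φ.Rel c R (fun j => xs j) ↔ Structure.RelMap R (g ∘ xs)) :
    Nonempty (Φ.Model c ≃[LA] A) := by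
  let F : Φ.Model c → A := Quot.lift g fun x y h => (hE x y).1 h
  have hF : Function.Bijective F := by
    refine ⟨?_, fun a => (hg a).imp' (Φ.cls c) fun _ => id⟩
    rintro ⟨x⟩ ⟨y⟩ h
    exact Quot.sound ((hE x y).2 h)
  have hrel {n : ℕ} (R : LA.Relations n) (q : Fin n → Φ.Model c) :
      Structure.RelMap R (F ∘ q) ↔ Structure.RelMap R q := by
    constructor
    · intro h
      choose xs hxs using fun j => Quot.exists_rep (q j)
      obtain rfl : (fun j => Φ.cls c (xs j)) = q := funext hxs
      exact ⟨xs, fun _ => rfl, (hR R xs).2 h⟩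
    · rintro ⟨xs, hxs, h⟩
      obtain rfl : (fun j => Φ.cls c (xs j)) = q := funext hxs
      exact (hR R xs).1 h
  exact ⟨⟨Equiv.ofBijective F hF, fun f => isEmptyElim f, hrel⟩⟩

theorem Presents.interprets {G : List B → A → Prop} (h : Φ.Presents c G)
    (hunique : Relator.RightUnique G) (htotal : Relator.RightTotal G) : Φ.Interprets c A := by
  choose g hg using fun x : Φ.D c => h.mem_D_iff.1 x.2
  have hG : ∀ (x : Φ.D c) a, G x a ↔ g x = a := fun x a =>
    ⟨hunique (hg x), fun hxa => hxa ▸ hg x⟩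
  have hE : ∀ x y : Φ.D c, Φ.Eqv c x y ↔ g x = g y := fun x y => by
    simp [h.eqv_iff, hG, eq_comm]
  have hR : ∀ {n : ℕ} (R : LA.Relations n) (xs : Fin n → Φ.D c),
      Φ.Rel c R (fun j => xs j) ↔ Structure.RelMap R (g ∘ xs) := fun R xs => by
    refine (h.rel R _).trans ?_
    simp only [hG]
    exact ⟨fun ⟨_, has, hT⟩ => (funext has : g ∘ xs = _) ▸ hT, fun hT => ⟨_, fun _ => rfl, hT⟩⟩
  refine ⟨fun x y hxy => ?_, ?_, fun x y => h.neqv_iff hunique, fun R xs hxs j => ?_,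
    fun R _ _ => h.rel_congr hunique R, h.nrel_iff hunique, nonempty_model_equiv ?_ hE hR⟩
  · obtain ⟨a, hxa, hya⟩ := h.eqv_iff.1 hxy
    exact ⟨h.mem_D_iff.2 ⟨a, hxa⟩, h.mem_D_iff.2 ⟨a, hya⟩⟩
  · simp only [hE]
    exact eq_equivalence.comap g
  · obtain ⟨as, has, -⟩ := (h.rel R xs).1 hxs
    exact h.mem_D_iff.2 ⟨_, has j⟩
  · intro a
    obtain ⟨x, hx⟩ := htotal a
    exact ⟨⟨x, h.mem_D_iff.2 ⟨a, hx⟩⟩, (hG _ _).1 hx⟩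

theorem Interprets.cls_eq_iff (hΦ : Φ.Interprets c A) (x y : Φ.D c) :
    Φ.cls c x = Φ.cls c y ↔ Φ.Eqv c x y :=
  Quot.eq.trans hΦ.eqv_equivalence.eqvGen_iff

theorem Interprets.relMap_cls (hΦ : Φ.Interprets c A) {n : ℕ} (R : LA.Relations n)
    (xs : Fin n → Φ.D c) :
    Structure.RelMap R (fun j => Φ.cls c (xs j)) ↔ Φ.Rel c R (fun j => xs j) := by
  constructor
  · rintro ⟨ys, hys, hr⟩
    exact (hΦ.rel_invariant R _ _ fun j => (hΦ.cls_eq_iff _ _).1 (hys j)).1 hr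
  · exact fun h => ⟨xs, fun _ => rfl, h⟩

theorem Interprets.presents (hΦ : Φ.Interprets c A) (e : Φ.Model c ≃[LA] A) :
    Φ.Presents c (Φ.ClassGraph c e) := by
  have eqv_iff (x y : Φ.D c) : e (Φ.cls c x) = e (Φ.cls c y) ↔ Φ.Eqv c x y :=
    e.injective.eq_iff.trans (hΦ.cls_eq_iff x y)
  have rel_iff {n : ℕ} (R : LA.Relations n) (xs : Fin n → Φ.D c) :
      Structure.RelMap R (fun j => e (Φ.cls c (xs j))) ↔ Φ.Rel c R (fun j => xs j) :=
    (e.map_rel R fun j => Φ.cls c (xs j)).trans (hΦ.relMap_cls R xs)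
  constructor
  case dom =>
    exact definesPullback_classGraph (fun _ h => Fin.forall_fin_one.2 h)
      fun xs => iff_of_true trivial (xs 0).2
  case eqv =>
    exact definesPullback_classGraph (fun _ h => Fin.forall_fin_two.2 (hΦ.eqv_dom _ _ h))
      fun xs => eqv_iff (xs 0) (xs 1)
  case neqv =>
    refine definesPullback_classGraph (fun xs h => ?_) fun xs => ?_
    · obtain ⟨hx, hy, -⟩ := (hΦ.neqv_iff (xs 0) (xs 1)).1 h
      exact Fin.forall_fin_two.2 ⟨hx, hy⟩
    · refine (not_congr (eqv_iff _ _)).trans (Iff.trans ?_ (hΦ.neqv_iff (xs 0) (xs 1)).symm)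
      simp only [Subtype.coe_prop, true_and]
  case rel =>
    exact fun R => definesPullback_classGraph (hΦ.rel_dom R) (rel_iff R)
  case nrel =>
    refine fun R => definesPullback_classGraph (fun xs h => ((hΦ.nrel_iff R xs).1 h).1)
      fun xs => ?_
    refine (not_congr (rel_iff R xs)).trans (Iff.trans ?_ (hΦ.nrel_iff R _).symm)
    simp only [Subtype.coe_prop, implies_true, true_and]

theorem Interprets.of_mem_orbit {b : Fin p → B} (hΦ : Φ.Interprets b A) (hc : c ∈ orbit LB b) :
    Φ.Interprets c A := by
  obtain ⟨σ, rfl⟩ := hc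
  obtain ⟨e⟩ := hΦ.iso
  refine ((hΦ.presents e).comp_equiv σ).interprets
    (fun _ _ _ hx hy => rightUnique_classGraph hx hy) (fun a => ?_)
  obtain ⟨x, hx⟩ := rightTotal_classGraph e.surjective a
  exact ⟨x.map σ, by simpa [Function.comp_def] using hx⟩

end Relational

/-- The formulas without parameters for the disjoint union of the interpretations with parameters
in the set defined by `φ`, in which tuples are identified along `F`. -/
def pool (φ : SigmaOneFormula LB p) (F : GenSigmaOneSeq LB Unit 0) (Φ : InterpFormulas LA LB p) :
    InterpFormulas LA LB 0 where
  dom := transfer φ Φ.dom F Φ.dom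
  eqv := transfer φ Φ.dom F Φ.eqv
  neqv := transfer φ Φ.dom F Φ.neqv
  rel := transfer φ Φ.dom F Φ.rel
  nrel := transfer φ Φ.dom F Φ.nrel

theorem presents_pool {S : Set (Fin p → B)} {G : S → List B → A → Prop}
    (hΦ : ∀ c : S, Φ.Presents c.1 (G c)) {φ : SigmaOneFormula LB p}
    (hφ : ∀ c : Fin p → B, φ.Realize () (List.ofFn c) ↔ c ∈ S) {F : GenSigmaOneSeq LB Unit 0}
    (hF : ∀ (c d : S) (x y : List B) (a b : A), G c x a → G d y b →
      (quaternary F c.1 d.1 x y ↔ a = b))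
    (c₀ : S) (hG : Relator.RightTotal (G c₀)) :
    (Φ.pool φ F).Presents (Fin.elim0 : Fin 0 → B) (Pooled G) where
  dom := .transfer hφ (fun c => (hΦ c).dom) hF c₀ hG fun c => (hΦ c).dom
  eqv := .transfer hφ (fun c => (hΦ c).dom) hF c₀ hG fun c => (hΦ c).eqv
  neqv := .transfer hφ (fun c => (hΦ c).dom) hF c₀ hG fun c => (hΦ c).neqv
  rel R := .transfer hφ (fun c => (hΦ c).dom) hF c₀ hG fun c => (hΦ c).rel R
  nrel R := .transfer hφ (fun c => (hΦ c).dom) hF c₀ hG fun c => (hΦ c).nrel R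

end InterpFormulas

theorem mem_orbit_self {L : FirstOrder.Language.{u₂, v₂}} {B : Type w₂} [L.Structure B] {p : ℕ}
    (b : Fin p → B) : b ∈ orbit L b :=
  ⟨FirstOrder.Language.Equiv.refl L B, rfl⟩

end EffInt

theorem mainTheorem4_general {LA : FirstOrder.Language.{u₁, v₁}}
    {LB : FirstOrder.Language.{u₂, v₂}} [LA.IsRelational]
    [EffInt.ComputableLanguage LA] [EffInt.ComputableLanguage LB]
    {A : Type w₁} [LA.Structure A] {B : Type w₂} [LB.Structure B]
    {p : ℕ} {S : Set (Fin p → B)} (hS : S.Nonempty) (Φ : EffInt.InterpFormulas LA LB p)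
    (hΦ : ∀ c ∈ S, Φ.Interprets c A) (φ : EffInt.SigmaOneFormula LB p)
    (hφ : ∀ c : Fin p → B, φ.Realize () (List.ofFn c) ↔ c ∈ S)
    (F : EffInt.GenSigmaOneSeq LB Unit 0)
    (f : ∀ c d : S, Φ.Model c.1 ≃[LA] Φ.Model d.1)
    (hf : ∀ (c d : S) (x : Φ.D c.1) (y : Φ.D d.1),
      f c d (Φ.cls c.1 x) = Φ.cls d.1 y ↔ EffInt.quaternary F c.1 d.1 x.1 y.1)
    (hcomp : ∀ c d e : S, (f d e).comp (f c d) = f c e) :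
    EffInt.EffectivelyInterpreted LA LB A B := by
  obtain ⟨b, hb⟩ := hS
  obtain ⟨e₀⟩ := (hΦ b hb).iso
  let e (c : S) : Φ.Model c.1 ≃[LA] A := e₀.comp (f c ⟨b, hb⟩)
  have he (c d : S) (q : Φ.Model c.1) : e d (f c d q) = e c q :=
    congrArg e₀ (DFunLike.congr_fun (hcomp c d ⟨b, hb⟩) q)
  have hF (c d : S) (x y : List B) (a a' : A) (hx : Φ.ClassGraph c.1 (e c) x a)
      (hy : Φ.ClassGraph d.1 (e d) y a') : EffInt.quaternary F c.1 d.1 x y ↔ a = a' := by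
    obtain ⟨hx, rfl⟩ := hx
    obtain ⟨hy, rfl⟩ := hy
    rw [← hf c d ⟨x, hx⟩ ⟨y, hy⟩, ← (e d).injective.eq_iff, he]
  have htotal (c : S) : Relator.RightTotal (Φ.ClassGraph c.1 (e c)) :=
    EffInt.InterpFormulas.rightTotal_classGraph (e c).surjective
  have hpool := EffInt.InterpFormulas.presents_pool (fun c : S => (hΦ c c.2).presents (e c)) hφ hF
    ⟨b, hb⟩ (htotal _)
  exact ⟨Φ.pool φ F, hpool.interprets
    (EffInt.rightUnique_pooled fun _ => EffInt.InterpFormulas.rightUnique_classGraph)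
    (EffInt.rightTotal_pooled _ (htotal ⟨b, hb⟩))⟩

theorem mainTheorem4 {LA : FirstOrder.Language.{u₁, v₁}} {LB : FirstOrder.Language.{u₂, v₂}} [LA.IsRelational]
    [EffInt.ComputableLanguage LA] [EffInt.ComputableLanguage LB]
    {A : Type w₁} [LA.Structure A] {B : Type w₂} [LB.Structure B]
    {p : ℕ} (b : Fin p → B) (Φ : EffInt.InterpFormulas LA LB p) (hΦ : Φ.Interprets b A)
    (φ : EffInt.SigmaOneFormula LB p)
    (hφ : ∀ c : Fin p → B, φ.Realize () (List.ofFn c) ↔ c ∈ EffInt.orbit LB b)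
    (F : EffInt.GenSigmaOneSeq LB Unit 0)
    (hFinv : ∀ c ∈ EffInt.orbit LB b, ∀ d ∈ EffInt.orbit LB b, ∀ x x' y y' : List B,
      Φ.Eqv c x x' → Φ.Eqv d y y' →
        (EffInt.quaternary F c d x y ↔ EffInt.quaternary F c d x' y'))
    (f : ∀ c d : EffInt.orbit LB b, Φ.Model c.1 ≃[LA] Φ.Model d.1)
    (hf : ∀ (c d : EffInt.orbit LB b) (x : Φ.D c.1) (y : Φ.D d.1),
      f c d (Φ.cls c.1 x) = Φ.cls d.1 y ↔
        EffInt.quaternary F c.1 d.1 x.1 y.1)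
    (hid : ∀ c : EffInt.orbit LB b, f c c = FirstOrder.Language.Equiv.refl LA (Φ.Model c.1))
    (hcomp : ∀ c d e : EffInt.orbit LB b, (f d e).comp (f c d) = f c e) :
    EffInt.EffectivelyInterpreted LA LB A B :=
  mainTheorem4_general ⟨b, EffInt.mem_orbit_self b⟩ Φ (fun _ hc => hΦ.of_mem_orbit hc) φ hφ F f hf
    hcomp
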